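/- Conventions. All sets live in a fixed universe. A similarity type consists of finitary operation symbols, algebras are nonempty, and a variety is a class of algebras of a fixed similarity type closed under homomorphic images, subalgebras and products. A class of algebras is locally $\le\mu$ if every finitely generated subalgebra of each of its members has at most $\mu$ elements. For an algebra $A$, $\mathrm{Con}_{\mathrm c}A$ is the $(\vee,0)$-semilattice of all compact (that is, finitely generated) congruences of $A$; for a homomorphism $f\colon A\to B$, $\mathrm{Con}_{\mathrm c}f$ sends $\alpha$ to the congruence of $B$ generated by $\{(f(x),f(y)) : (x,y)\in\alpha\}$. This is a functor to the category $\mathcal S$ of all $(\vee,0)$-semilattices and $(\vee,0)$-homomorphisms. A lifting of a functor $\mathcal D\colon J\to\mathcal S$ in a variety $\mathcal V$ is a functor $\mathcal A\colon J\to\mathcal V$ such that $\mathrm{Con}_{\mathrm c}\circ\mathcal A$ is naturally isomorphic to $\mathcal D$. A well-founded tree is a poset with a smallest element in which every principal lower subset $\mathop{\downarrow} t=\{s : s\le t\}$ is a well-founded chain. Posets are regarded as categories, products of posets are ordered componentwise, $\kappa^+$ is the successor cardinal of $\kappa$ and $\kappa^{+n}$ its $n$-th successor. Statement. Let $\mathcal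 V_1$ be a variety of $\mathscr L_1$-algebras and $\mathcal V_2$ a variety of $\mathscr L_2$-algebras, for similarity types $\mathscr L_1,\mathscr L_2$. Let $\kappa$ be an infinite cardinal, let $I_1,\dots,I_n$ be well-founded trees, and let $J$ be a small category, such that: 1. $\mathcal V_1$ is locally $\le\kappa^+$ and $\mathcal V_2$ is locally $\le\kappa$. 2. $\mathrm{card}\,I_1+\dots+\mathrm{card}\,I_{n-1}+\mathrm{card}\,\mathrm{Mor}\,J\le\kappa$, where $\mathrm{Mor}\,J$ is the set of all morphisms of $J$. 3. $\mathrm{card}\,I_n\le\kappa^+$. 4. $\mathrm{card}(\mathop{\downarrow} i)\le\kappa$ for each $i\in I_n$. 5. Every functor $\mathcal D\colon J\to\mathcal S$ such that $\mathrm{card}\,\mathcal D(j)\le\kappa^{+n}$ for all objects $j$ of $J$, and which has a lifting in $\mathcal V_1$, has a lifting in $\mathcal V_2$. Then every functor $\mathcal D\colon I_1\times\dots\times I_n\times J\to\mathcal S$ such that $\mathrm{card}\,\mathcal D(i_1,\dots,i_n,j)\le\kappa$ for all $(i_1,\dots,i_n,j)\in I_1\times\dots\times I_n\times\mathrm{Ob}\,J$,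 and which has a lifting in $\mathcal V_1$, has a lifting in $\mathcal V_2$. (For $n=0$, conditions 3 and 4 and the sum over the trees are void.) -/

import Mathlib

open CategoryTheory
open scoped FirstOrder

universe u v w x y x₁ y₁ x₂ y₂

namespace LiftingDiagrams

/-! ### Algebras of a similarity type

A similarity type is a first-order language `L` without relation symbols (`L.IsAlgebraic`); an
`L`-algebra is a nonempty `L`-structure. -/

/-- The (nonempty) algebras of similarity type `L`. -/
structure Alg (L : FirstOrder.Language.{x, y}) : Type (max x y (u + 1)) where
  /-- the underlying set of the algebra -/
  carrier : Type u
  [str : L.Structure carrier]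
  [nonempty : Nonempty carrier]

namespace Alg

variable {L : FirstOrder.Language.{x, y}}

instance : CoeSort (Alg.{u} L) (Type u) := ⟨Alg.carrier⟩

attribute [instance] Alg.str Alg.nonempty

/-- The category of `L`-algebras and homomorphisms. -/
instance : Category (Alg.{u} L) where
  Hom A B := A →[L] B
  id A := FirstOrder.Language.Hom.id L A
  comp f g := FirstOrder.Language.Hom.comp g f

end Alg

/-- The product of a family of `L`-structures, with operations (and relations) defined
componentwise. -/
instance piStructure {L : FirstOrder.Language.{x, y}} {ι : Type v} (A : ι → Type w)
    [∀ i, L.Structure (A i)] : L.Structure (∀ i, A i) where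
  funMap f a := fun i => FirstOrder.Language.Structure.funMap f (fun k => a k i)
  RelMap r a := ∀ i, FirstOrder.Language.Structure.RelMap r (fun k => a k i)

/-- A variety of `L`-algebras: a class of `L`-algebras closed under homomorphic images, (nonempty)
subalgebras and products. -/
structure IsVariety {L : FirstOrder.Language.{x, y}} (V : ObjectProperty (Alg.{u} L)) : Prop where
  image : ∀ (A B : Alg.{u} L) (f : A →[L] B), Function.Surjective f → V A → V B
  sub : ∀ (A : Alg.{u} L) (S : L.Substructure A) [Nonempty S], V A → V (Alg.mk S)
  prod : ∀ (ι : Type u) (A : ι → Alg.{u} L), (∀ i, V (A i)) → V (Alg.mk (∀ i, A i))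

/-- A class of `L`-algebras is locally `≤ κ` if every finitely generated subalgebra of each of its
members has at most `κ` elements. -/
def LocallyLE {L : FirstOrder.Language.{x, y}} (V : ObjectProperty (Alg.{u} L)) (κ : Cardinal.{u}) : Prop :=
  ∀ A : Alg.{u} L, V A → ∀ S : L.Substructure A, S.FG → Cardinal.mk S ≤ κ

/-! ### Congruences -/

section Congruence

variable (L : FirstOrder.Language.{x, y})

/-- A congruence of an `L`-algebra: an equivalence relation compatible with all operations. -/
structure Congr (A : Type u) [L.Structure A] extends Setoid A where
  compat : ∀ {n : ℕ} (f : L.Functions n) (a b : Fin n → A), (∀ i, toSetoid.r (a i) (b i)) →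
    toSetoid.r (FirstOrder.Language.Structure.funMap f a) (FirstOrder.Language.Structure.funMap f b)

namespace Congr

variable {L}
variable {A : Type u} {B : Type v} {C : Type w} [L.Structure A] [L.Structure B] [L.Structure C]

/-- The relation underlying a congruence. -/
def Rel (θ : Congr L A) (a b : A) : Prop := θ.toSetoid.r a b

theorem ext' {θ φ : Congr L A} (h : ∀ a b, θ.Rel a b ↔ φ.Rel a b) : θ = φ := by
  obtain ⟨s, hs⟩ := θ
  obtain ⟨t, ht⟩ := φ
  have : s = t := Setoid.ext h
  subst this
  rfl

/-- Congruences are ordered by inclusion. -/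
instance : PartialOrder (Congr L A) where
  le θ φ := ∀ a b, θ.Rel a b → φ.Rel a b
  le_refl _ _ _ h := h
  le_trans _ _ _ h₁ h₂ a b h := h₂ a b (h₁ a b h)
  le_antisymm _ _ h₁ h₂ := ext' fun a b => ⟨h₁ a b, h₂ a b⟩

/-- The smallest congruence of `A` containing the set of pairs `P`. -/
def gen (P : Set (A × A)) : Congr L A where
  r a b := ∀ θ : Congr L A, (∀ p ∈ P, θ.Rel p.1 p.2) → θ.Rel a b
  iseqv :=
    ⟨fun a θ _ => θ.iseqv.refl a, fun h θ hP => θ.iseqv.symm (h θ hP),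
      fun h₁ h₂ θ hP => θ.iseqv.trans (h₁ θ hP) (h₂ θ hP)⟩
  compat f a b h θ hP := θ.compat f a b fun i => h i θ hP

theorem gen_le {P : Set (A × A)} {θ : Congr L A} :
    gen P ≤ θ ↔ ∀ p ∈ P, θ.Rel p.1 p.2 :=
  ⟨fun h p hp => h _ _ fun _ hφ => hφ p hp, fun h _ _ hab => hab θ h⟩

/-- The set of pairs of a congruence. -/
def pairs (θ : Congr L A) : Set (A × A) := {p | θ.Rel p.1 p.2}

/-- The inverse image of a congruence under a homomorphism. -/
def comap (f : A →[L] B) (φ : Congr L B) : Congr L A where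
  r a b := φ.Rel (f a) (f b)
  iseqv :=
    ⟨fun _ => φ.iseqv.refl _, fun h => φ.iseqv.symm h, fun h₁ h₂ => φ.iseqv.trans h₁ h₂⟩
  compat g a b h := by
    have := φ.compat g (f ∘ a) (f ∘ b) h
    rw [← f.map_fun, ← f.map_fun] at this
    exact this

/-- `Con f`: sends `α` to the congruence of `B` generated by all `(f a, f b)` with `(a, b) ∈ α`. -/
def map (f : A →[L] B) (α : Congr L A) : Congr L B :=
  gen (Prod.map f f '' α.pairs)

theorem map_le {f : A →[L] B} {α : Congr L A} {φ : Congr L B} :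
    map f α ≤ φ ↔ α ≤ comap f φ := by
  rw [map, gen_le]
  constructor
  · intro h a b hab
    exact h _ ⟨(a, b), hab, rfl⟩
  · rintro h _ ⟨⟨a, b⟩, hab, rfl⟩
    exact h a b hab

theorem map_gen (f : A →[L] B) (P : Set (A × A)) :
    map f (gen P) = gen (Prod.map f f '' P) := by
  apply eq_of_forall_ge_iff
  intro φ
  rw [map_le, gen_le, gen_le, Set.forall_mem_image]
  rfl

theorem map_id (α : Congr L A) : map (FirstOrder.Language.Hom.id L A) α = α := by
  apply eq_of_forall_ge_iff
  intro φ
  rw [map_le]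
  rfl

theorem map_comp (g : B →[L] C) (f : A →[L] B) (α : Congr L A) :
    map (g.comp f) α = map g (map f α) := by
  apply eq_of_forall_ge_iff
  intro φ
  rw [map_le, map_le, map_le]
  rfl

end Congr

/-- `Conc A`: the set of finitely generated (equivalently, compact) congruences of `A`. -/
def Conc (A : Type u) [L.Structure A] : Type u :=
  {θ : Congr L A // ∃ P : Finset (A × A), θ = Congr.gen (P : Set (A × A))}

namespace Conc

variable {L}
variable {A : Type u} {B : Type v} [L.Structure A] [L.Structure B]

open Classical in
theorem exists_sup (θ φ : Conc L A) :
    ∃ ψ : Conc L A, ∀ χ : Congr L A, ψ.1 ≤ χ ↔ θ.1 ≤ χ ∧ φ.1 ≤ χ := by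
  obtain ⟨_, P, rfl⟩ := θ
  obtain ⟨_, Q, rfl⟩ := φ
  refine ⟨⟨_, P ∪ Q, rfl⟩, fun χ => ?_⟩
  simp only [Congr.gen_le, Finset.coe_union, Set.mem_union, or_imp, forall_and]

instance : PartialOrder (Conc L A) := Subtype.partialOrder _

/-- The join is the join in the lattice of all congruences, which is finitely generated. -/
noncomputable instance : SemilatticeSup (Conc L A) where
  sup θ φ := (exists_sup θ φ).choose
  le_sup_left θ φ := (((exists_sup θ φ).choose_spec _).1 le_rfl).1
  le_sup_right θ φ := (((exists_sup θ φ).choose_spec _).1 le_rfl).2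
  sup_le θ φ χ h₁ h₂ := ((exists_sup θ φ).choose_spec χ.1).2 ⟨h₁, h₂⟩

theorem sup_le_iff' (θ φ : Conc L A) (χ : Congr L A) :
    (θ ⊔ φ).1 ≤ χ ↔ θ.1 ≤ χ ∧ φ.1 ≤ χ :=
  (exists_sup θ φ).choose_spec χ

/-- The zero of `Conc A` is the congruence generated by no pairs, which is the identity. -/
instance : OrderBot (Conc L A) where
  bot := ⟨Congr.gen ∅, ∅, by simp⟩
  bot_le _ := Congr.gen_le.2 fun _ h => h.elim

theorem bot_le' (χ : Congr L A) : (⊥ : Conc L A).1 ≤ χ := Congr.gen_le.2 fun _ h => h.elim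

/-- `Conc f`, the restriction of `Con f`. -/
def map (f : A →[L] B) (θ : Conc L A) : Conc L B :=
  ⟨Congr.map f θ.1, by
    classical
    obtain ⟨_, P, rfl⟩ := θ
    exact ⟨P.image (Prod.map f f), by rw [Congr.map_gen, Finset.coe_image]⟩⟩

theorem map_le {f : A →[L] B} {α : Conc L A} {φ : Congr L B} :
    (map f α).1 ≤ φ ↔ α.1 ≤ Congr.comap f φ := Congr.map_le

/-- `Conc f` as a `(∨,0)`-homomorphism. -/
def mapHom (f : A →[L] B) : SupBotHom (Conc L A) (Conc L B) where
  toFun := map f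
  map_sup' θ φ := by
    apply Subtype.ext
    apply eq_of_forall_ge_iff
    intro χ
    rw [map_le, sup_le_iff', sup_le_iff', map_le, map_le]
  map_bot' := by
    apply Subtype.ext
    apply eq_of_forall_ge_iff
    intro χ
    rw [map_le]
    exact iff_of_true (bot_le' _) (bot_le' _)

end Conc

/-- The functor `Conc` from the category of `L`-algebras to the category of all
`(∨,0)`-semilattices and `(∨,0)`-homomorphisms. -/
noncomputable def concFunctor : Alg.{u} L ⥤ SemilatSupCat.{u} where
  obj A := SemilatSupCat.of (Conc L A)
  map {A B} f := Conc.mapHom (A := A) (B := B) f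
  map_id A := by
    apply SupBotHom.ext
    intro θ
    exact Subtype.ext (Congr.map_id θ.1)
  map_comp {A B C} f g := by
    apply SupBotHom.ext
    intro θ
    exact Subtype.ext (Congr.map_comp (A := A) (B := B) (C := C) g f θ.1)

end Congruence

/-- A diagram `D` of `(∨,0)`-semilattices has a lifting in the class `V` of `L`-algebras: there is
a functor `𝒜` to `V` (the full subcategory) with `Conc ∘ 𝒜` naturally isomorphic to `D`. -/
def HasLifting {L : FirstOrder.Language.{x, y}} (V : ObjectProperty (Alg.{u} L))
    {J : Type v} [Category.{w} J] (D : J ⥤ SemilatSupCat.{u}) : Prop :=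
  ∃ 𝒜 : J ⥤ V.FullSubcategory, Nonempty (𝒜 ⋙ V.ι ⋙ concFunctor L ≅ D)

/-! ### Well-founded trees -/

/-- A well-founded tree: a poset with a smallest element in which every principal lower subset is a
well-founded chain. -/
structure IsWellFoundedTree (T : Type u) [PartialOrder T] : Prop where
  exists_least : ∃ b : T, ∀ t, b ≤ t
  isChain_Iic : ∀ t : T, IsChain (· ≤ ·) (Set.Iic t)
  isWF_Iic : ∀ t : T, (Set.Iic t).IsWF

/-- The product poset of a finite family of posets, with the componentwise order; it is regarded
as a category through `Preorder.smallCategory`. -/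
def PosetProd {n : ℕ} (I : Fin n → Type u) : Type u := ∀ k, I k

instance {n : ℕ} (I : Fin n → Type u) [∀ k, PartialOrder (I k)] : PartialOrder (PosetProd I) :=
  inferInstanceAs (PartialOrder (∀ k, I k))

end LiftingDiagrams

namespace LiftingDiagrams

namespace Congr

variable {L : FirstOrder.Language.{x, y}} {A : Type u} {B : Type v} [L.Structure A] [L.Structure B]

theorem rel_refl (θ : Congr L A) (a : A) : θ.Rel a a := θ.iseqv.refl a

theorem Rel.symm {θ : Congr L A} {a b : A} (h : θ.Rel a b) : θ.Rel b a := θ.iseqv.symm h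

theorem Rel.trans {θ : Congr L A} {a b c : A} (h : θ.Rel a b) (h' : θ.Rel b c) : θ.Rel a c :=
  θ.iseqv.trans h h'

theorem rel_funMap (θ : Congr L A) {n : ℕ} (f : L.Functions n) {a b : Fin n → A}
    (h : ∀ i, θ.Rel (a i) (b i)) :
    θ.Rel (FirstOrder.Language.Structure.funMap f a) (FirstOrder.Language.Structure.funMap f b) :=
  θ.compat f a b h

theorem rel_gen_of_mem {P : Set (A × A)} {a b : A} (h : (a, b) ∈ P) :
    (gen P : Congr L A).Rel a b := fun _ hθ => hθ _ h

theorem gen_mono {P Q : Set (A × A)} (h : P ⊆ Q) : (gen P : Congr L A) ≤ gen Q :=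
  gen_le.2 fun _ hp => rel_gen_of_mem (h hp)

theorem le_gen_union_left (α : Congr L A) (P : Set (A × A)) : α ≤ gen (α.pairs ∪ P) :=
  fun _ _ h => rel_gen_of_mem (Or.inl h)

/-- The kernel of a homomorphism. -/
def ker (f : A →[L] B) : Congr L A where
  r a b := f a = f b
  iseqv := ⟨fun _ => rfl, fun h => h.symm, fun h₁ h₂ => h₁.trans h₂⟩
  compat g a b h := by
    rw [f.map_fun, f.map_fun]
    exact congrArg _ (funext h)

/-- A pair in the congruence generated by `P` is in the congruence generated by a finite subset
of `P`. -/
theorem exists_finset_of_rel_gen {P : Set (A × A)} {a b : A} (h : (gen P : Congr L A).Rel a b) :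
    ∃ Q : Finset (A × A), (Q : Set (A × A)) ⊆ P ∧ (gen (Q : Set (A × A)) : Congr L A).Rel a b := by
  classical
  let θ : Congr L A :=
    { r := fun a b => ∃ Q : Finset (A × A), (Q : Set (A × A)) ⊆ P ∧
        (gen (Q : Set (A × A)) : Congr L A).Rel a b
      iseqv := by
        refine ⟨fun a => ⟨∅, by simp, rel_refl _ _⟩, ?_, ?_⟩
        · rintro a b ⟨Q, hQ, h⟩
          exact ⟨Q, hQ, h.symm⟩
        · rintro a b c ⟨Q, hQ, h⟩ ⟨R, hR, h'⟩
          refine ⟨Q ∪ R, by simp [hQ, hR], Rel.trans (gen_mono ?_ _ _ h) (gen_mono ?_ _ _ h')⟩ <;>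
            simp
      compat := by
        intro n f a b h
        choose Q hQ hR using h
        refine ⟨Finset.univ.biUnion Q, by simpa using hQ, rel_funMap _ f fun i => ?_⟩
        refine gen_mono ?_ _ _ (hR i)
        exact_mod_cast Finset.subset_biUnion_of_mem Q (Finset.mem_univ i) }
  exact h θ fun p hp => ⟨{p}, by simpa using hp, rel_gen_of_mem (by simp)⟩

/-- A pair in the congruence generated by `P` is in the congruence generated by the restriction
of `P` to any sufficiently large subalgebra. -/
theorem exists_finset_forall_substructure {P : Set (A × A)} {a b : A}
    (h : (gen P : Congr L A).Rel a b) :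
    ∃ E : Finset A, ∀ C : L.Substructure A, (E : Set A) ⊆ C → ∃ (ha : a ∈ C) (hb : b ∈ C),
      (gen {p : C × C | ((p.1 : A), (p.2 : A)) ∈ P} : Congr L C).Rel ⟨a, ha⟩ ⟨b, hb⟩ := by
  classical
  let θ : Congr L A :=
    { r := fun a b => ∃ E : Finset A, ∀ C : L.Substructure A, (E : Set A) ⊆ C →
        ∃ (ha : a ∈ C) (hb : b ∈ C),
          (gen {p : C × C | ((p.1 : A), (p.2 : A)) ∈ P} : Congr L C).Rel ⟨a, ha⟩ ⟨b, hb⟩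
      iseqv := by
        refine ⟨fun a => ⟨{a}, fun C hC => ?_⟩, ?_, ?_⟩
        · have : a ∈ C := hC (by simp)
          exact ⟨this, this, rel_refl _ _⟩
        · rintro a b ⟨E, h⟩
          refine ⟨E, fun C hC => ?_⟩
          obtain ⟨ha, hb, h⟩ := h C hC
          exact ⟨hb, ha, h.symm⟩
        · rintro a b c ⟨E, h⟩ ⟨E', h'⟩
          refine ⟨E ∪ E', fun C hC => ?_⟩
          rw [Finset.coe_union, Set.union_subset_iff] at hC
          obtain ⟨ha, hb, h⟩ := h C hC.1
          obtain ⟨_, hc, h'⟩ := h' C hC.2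
          exact ⟨ha, hc, h.trans h'⟩
      compat := by
        intro n f a b h
        choose E hE using h
        refine ⟨Finset.univ.biUnion E, fun C hC => ?_⟩
        have hC' : ∀ i, (E i : Set A) ⊆ C := fun i => subset_trans
          (by exact_mod_cast Finset.subset_biUnion_of_mem E (Finset.mem_univ i)) hC
        choose ha hb h using fun i => hE i C (hC' i)
        exact ⟨C.fun_mem f _ ha, C.fun_mem f _ hb, rel_funMap _ f h⟩ }
  refine h θ fun p hp => ⟨{p.1, p.2}, fun C hC => ?_⟩
  have h₁ : p.1 ∈ C := hC (by simp)
  have h₂ : p.2 ∈ C := hC (by simp)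
  exact ⟨h₁, h₂, rel_gen_of_mem hp⟩

/-- For a surjective homomorphism `f`, the inverse image of the image of `β` is the join of `β`
and the kernel of `f`. -/
theorem comap_map_le {f : A →[L] B} (hf : Function.Surjective f) (β : Congr L A) :
    comap f (map f β) ≤ gen (β.pairs ∪ (ker f).pairs) := by
  set ψ : Congr L A := gen (β.pairs ∪ (ker f).pairs) with hψ
  have hker : ∀ a b, f a = f b → ψ.Rel a b := fun a b h => rel_gen_of_mem (Or.inr h)
  let g := Function.surjInv hf
  have hg : ∀ b, f (g b) = b := Function.surjInv_eq hf
  let χ : Congr L B :=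
    { r := fun a b => ψ.Rel (g a) (g b)
      iseqv := ⟨fun _ => rel_refl _ _, fun h => h.symm, fun h h' => h.trans h'⟩
      compat := by
        intro n k a b h
        have key : ∀ c : Fin n → B, ψ.Rel (g (FirstOrder.Language.Structure.funMap k c))
            (FirstOrder.Language.Structure.funMap k fun i => g (c i)) := by
          intro c
          apply hker
          rw [hg, f.map_fun]
          exact congrArg _ (funext fun i => (hg _).symm)
        exact (key a).trans ((rel_funMap _ k h).trans (key b).symm) }
  have h₁ : map f β ≤ χ := map_le.2 fun a b hab =>
    (hker (g (f a)) a (hg _)).trans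
      (Rel.trans (rel_gen_of_mem (Or.inl hab)) (hker b (g (f b)) (hg _).symm))
  intro a b hab
  exact (hker a (g (f a)) (hg _).symm).trans
    (Rel.trans (a := g (f a)) (h₁ _ _ hab) (hker (g (f b)) b (hg _)))

section Quotient

variable [L.IsAlgebraic]

/-- The quotient of an algebra by a congruence. -/
def Quot (θ : Congr L A) : Type u := Quotient θ.toSetoid

noncomputable instance (θ : Congr L A) : L.Structure θ.Quot where
  funMap f a := Quotient.mk θ.toSetoid
    (FirstOrder.Language.Structure.funMap f fun i => Quotient.out (s := θ.toSetoid) (a i))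
  RelMap r _ := isEmptyElim r

/-- The canonical projection onto a quotient. -/
def toQuot (θ : Congr L A) : A →[L] θ.Quot where
  toFun := Quotient.mk θ.toSetoid
  map_fun' f a := by
    apply Quotient.sound
    exact θ.compat f _ _ fun i => θ.iseqv.symm (Quotient.mk_out (s := θ.toSetoid) (a i))
  map_rel' r _ _ := isEmptyElim r

theorem toQuot_surjective (θ : Congr L A) : Function.Surjective θ.toQuot := Quotient.exists_rep

theorem toQuot_eq_toQuot {θ : Congr L A} {a b : A} : θ.toQuot a = θ.toQuot b ↔ θ.Rel a b :=
  Quotient.eq (r := θ.toSetoid)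

/-- The homomorphism induced between quotients. -/
noncomputable def quotMap (θ : Congr L A) (φ : Congr L B) (f : A →[L] B)
    (h : ∀ a b, θ.Rel a b → φ.Rel (f a) (f b)) : θ.Quot →[L] φ.Quot where
  toFun := Quotient.lift (fun a => φ.toQuot (f a)) fun a b hab => toQuot_eq_toQuot.2 (h a b hab)
  map_fun' g a := by
    obtain ⟨a, rfl⟩ : ∃ b : _ → A, a = fun i => θ.toQuot (b i) :=
      ⟨fun i => (θ.toQuot_surjective (a i)).choose,
        funext fun i => ((θ.toQuot_surjective (a i)).choose_spec).symm⟩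
    have := θ.toQuot.map_fun g a
    change _ = FirstOrder.Language.Structure.funMap g fun i => θ.toQuot (a i) at this
    rw [← this]
    change φ.toQuot (f _) = FirstOrder.Language.Structure.funMap g fun i => φ.toQuot (f (a i))
    rw [f.map_fun, φ.toQuot.map_fun]
    rfl
  map_rel' r _ _ := isEmptyElim r

end Quotient

end Congr

namespace Conc

variable {L : FirstOrder.Language.{x, y}} {A : Type u} {B : Type v} [L.Structure A] [L.Structure B]

/-- The principal congruence generated by a pair. -/
def principal (a b : A) : Conc L A := ⟨Congr.gen {(a, b)}, {(a, b)}, by simp⟩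

theorem principal_le {a b : A} {θ : Congr L A} : (principal a b).1 ≤ θ ↔ θ.Rel a b := by
  simp [principal, Congr.gen_le]

theorem principal_le' {a b : A} {θ : Conc L A} : principal a b ≤ θ ↔ θ.1.Rel a b :=
  principal_le

/-- The compact congruence generated by a finite set. -/
def genF (P : Finset (A × A)) : Conc L A := ⟨Congr.gen P, P, rfl⟩

theorem exists_eq_genF (α : Conc L A) : ∃ P : Finset (A × A), α = genF P := by
  obtain ⟨_, P, rfl⟩ := α
  exact ⟨P, rfl⟩

theorem map_genF [DecidableEq (B × B)] (f : A →[L] B) (P : Finset (A × A)) :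
    map f (genF P : Conc L A) = genF (P.image (Prod.map f f)) :=
  Subtype.ext (by simp [genF, map, Congr.map_gen])

theorem map_principal (f : A →[L] B) (a b : A) :
    map f (principal a b : Conc L A) = principal (f a) (f b) :=
  Subtype.ext (by simp [principal, map, Congr.map_gen])

theorem map_surjective {f : A →[L] B} (hf : Function.Surjective f) :
    Function.Surjective (map f) := by
  classical
  intro β
  obtain ⟨P, rfl⟩ := exists_eq_genF β
  refine ⟨genF (P.image (Prod.map (Function.surjInv hf) (Function.surjInv hf))), ?_⟩
  have : Prod.map f f ∘ Prod.map (Function.surjInv hf) (Function.surjInv hf) = id := by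
    ext p <;> simp [Function.surjInv_eq hf]
  rw [map_genF, Finset.image_image, this, Finset.image_id]

/-- For a surjective homomorphism `f`, the map `Conc f` is induced by an ideal of `Conc A`. -/
theorem exists_le_sup_of_map_le {f : A →[L] B} (hf : Function.Surjective f) {α β : Conc L A}
    (h : map f α ≤ map f β) : ∃ γ : Conc L A, map f γ = ⊥ ∧ α ≤ β ⊔ γ := by
  classical
  have h₁ : α.1 ≤ Congr.gen (β.1.pairs ∪ (Congr.ker f).pairs) :=
    le_trans (map_le.1 h) (Congr.comap_map_le hf β.1)
  obtain ⟨P, rfl⟩ := exists_eq_genF α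
  have h₂ : ∀ p : P, ∃ Q : Finset (A × A), (Q : Set (A × A)) ⊆ β.1.pairs ∪ (Congr.ker f).pairs ∧
      (Congr.gen (Q : Set (A × A)) : Congr L A).Rel p.1.1 p.1.2 := fun p =>
    Congr.exists_finset_of_rel_gen (Congr.gen_le.1 h₁ p.1 p.2)
  choose Q hQ hR using h₂
  let K : Finset (A × A) := (Finset.univ.biUnion Q).filter fun p => f p.1 = f p.2
  refine ⟨genF K, ?_, ?_⟩
  · apply le_antisymm _ bot_le
    change (map f (genF K)).1 ≤ (⊥ : Conc L B).1
    rw [map_le]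
    apply Congr.gen_le.2
    intro p hp
    have : f p.1 = f p.2 := (Finset.mem_filter.1 hp).2
    change (⊥ : Conc L B).1.Rel (f p.1) (f p.2)
    rw [this]
    exact Congr.rel_refl _ _
  · apply Congr.gen_le.2
    intro p hp
    refine Congr.gen_le.2 ?_ _ _ (hR ⟨p, hp⟩)
    intro q hq
    rcases hQ ⟨p, hp⟩ hq with h | h
    · exact (le_sup_left : β ≤ β ⊔ genF K) _ _ h
    · refine (le_sup_right : genF K ≤ β ⊔ genF K) _ _ (Congr.rel_gen_of_mem ?_)
      refine Finset.mem_filter.2 ⟨Finset.mem_biUnion.2 ⟨⟨p, hp⟩, Finset.mem_univ _, hq⟩, h⟩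

section SupBotHom

variable {S : Type w} [SemilatticeSup S] [OrderBot S]

/-- The largest congruence all of whose principal subcongruences are sent below `s`. -/
def congrLE (σ : SupBotHom (Conc L A) S) (s : S) : Congr L A where
  r a b := σ (principal a b) ≤ s
  iseqv := by
    have hm : Monotone σ := OrderHomClass.mono σ
    refine ⟨fun a => ?_, fun {a b} h => ?_, fun {a b c} h h' => ?_⟩
    · have : (principal a a : Conc L A) = ⊥ :=
        le_antisymm (principal_le'.2 (Congr.rel_refl _ _)) bot_le
      rw [this, map_bot]
      exact bot_le
    · refine le_trans (hm ?_) h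
      exact principal_le'.2 (Congr.Rel.symm (principal_le'.1 le_rfl))
    · refine le_trans (hm (b := principal a b ⊔ principal b c) ?_) ?_
      · exact principal_le'.2 (Congr.Rel.trans
          (principal_le'.1 le_sup_left) (principal_le'.1 le_sup_right))
      · rw [map_sup]
        exact sup_le h h'
  compat := by
    intro n f a b h
    have hm : Monotone σ := OrderHomClass.mono σ
    refine le_trans (hm (b := Finset.univ.sup fun i => principal (a i) (b i)) ?_) ?_
    · refine principal_le'.2 (Congr.rel_funMap _ f fun i => principal_le'.1 ?_)
      exact Finset.le_sup (f := fun i => principal (L := L) (a i) (b i)) (Finset.mem_univ i)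
    · rw [map_finset_sup]
      exact Finset.sup_le fun i _ => h i

theorem le_congrLE {σ : SupBotHom (Conc L A) S} {s : S} {γ : Conc L A} :
    γ.1 ≤ congrLE σ s ↔ σ γ ≤ s := by
  classical
  have hm : Monotone σ := OrderHomClass.mono σ
  constructor
  · intro h
    obtain ⟨P, rfl⟩ := exists_eq_genF γ
    refine le_trans (hm (b := P.sup fun p => principal p.1 p.2) ?_) ?_
    · refine Congr.gen_le.2 fun p hp => principal_le'.1 ?_
      exact Finset.le_sup (f := fun p : A × A => principal (L := L) p.1 p.2) hp
    · rw [map_finset_sup]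
      exact Finset.sup_le fun p hp => h _ _ (Congr.rel_gen_of_mem hp)
  · intro h a b hab
    exact le_trans (hm (principal_le'.2 hab)) h

/-- If `σ` is induced by an ideal then `σ α ≤ σ β` means that `α` is below the join of `β` and
the congruence that `σ` collapses. -/
theorem apply_le_apply_iff {σ : SupBotHom (Conc L A) S}
    (hσ : ∀ α β, σ α ≤ σ β → ∃ γ, σ γ = ⊥ ∧ α ≤ β ⊔ γ) {α β : Conc L A} :
    σ α ≤ σ β ↔ α.1 ≤ Congr.gen (β.1.pairs ∪ (congrLE σ ⊥).pairs) := by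
  constructor
  · intro h
    obtain ⟨γ, hγ, hα⟩ := hσ α β h
    refine le_trans (b := (β ⊔ γ).1) hα ((sup_le_iff' _ _ _).2 ⟨?_, ?_⟩)
    · exact Congr.le_gen_union_left _ _
    · refine le_trans (le_congrLE.2 hγ.le) ?_
      exact fun _ _ h => Congr.rel_gen_of_mem (Or.inr h)
  · intro h
    refine le_congrLE.1 (h.trans (Congr.gen_le.2 ?_))
    rintro p (hp | hp)
    · exact le_congrLE.2 le_rfl _ _ hp
    · exact le_trans (b := ⊥) hp bot_le

end SupBotHom

end Conc

section Cardinality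

open Cardinal

variable {T : Type u} {μ : Cardinal.{u}}

theorem mk_iUnion_le_of_le {ι : Type u} (hμ : ℵ₀ ≤ μ) (hι : #ι ≤ μ) {f : ι → Set T}
    (hf : ∀ i, #(f i) ≤ μ) : #(⋃ i, f i : Set T) ≤ μ :=
  mk_iUnion_le_sum_mk.trans <| (sum_le_sum _ _ hf).trans <| by
    rw [sum_const']
    exact (mul_le_mul' hι le_rfl).trans (mul_eq_self hμ).le

theorem mk_biUnion_le_of_le {ι : Type u} (hμ : ℵ₀ ≤ μ) {s : Set ι} (hs : #s ≤ μ) {f : ι → Set T}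
    (hf : ∀ i ∈ s, #(f i) ≤ μ) : #(⋃ i ∈ s, f i : Set T) ≤ μ := by
  rw [Set.biUnion_eq_iUnion]
  exact mk_iUnion_le_of_le hμ hs fun i => hf i i.2

theorem mk_union_le_of_le (hμ : ℵ₀ ≤ μ) {s t : Set T} (hs : #s ≤ μ) (ht : #t ≤ μ) :
    #(s ∪ t : Set T) ≤ μ :=
  (mk_union_le s t).trans ((add_le_add hs ht).trans (add_eq_self hμ).le)

theorem mk_finset_coe_le (hμ : ℵ₀ ≤ μ) (s : Finset T) : #(s : Set T) ≤ μ :=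
  (Cardinal.lt_aleph0_of_finite _).le.trans hμ

theorem mk_finset_le_of_le (hμ : ℵ₀ ≤ μ) (hT : #T ≤ μ) : #(Finset T) ≤ μ := by
  rcases finite_or_infinite T with h | h
  · exact (Cardinal.lt_aleph0_of_finite _).le.trans hμ
  · rwa [mk_finset_of_infinite]

theorem mk_prod_le_of_le (hμ : ℵ₀ ≤ μ) {T' : Type u} (hT : #T ≤ μ) (hT' : #T' ≤ μ) :
    #(T × T') ≤ μ := by
  rw [mk_prod, lift_id, lift_id]
  exact (mul_le_mul' hT hT').trans (mul_eq_self hμ).le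

theorem mk_sigma_le_of_le {ι : Type u} (hμ : ℵ₀ ≤ μ) (hι : #ι ≤ μ) {T : ι → Type u}
    (hT : ∀ i, #(T i) ≤ μ) : #(Σ i, T i) ≤ μ := by
  rw [mk_sigma]
  refine (sum_le_sum _ _ hT).trans ?_
  rw [sum_const']
  exact (mul_le_mul' hι le_rfl).trans (mul_eq_self hμ).le

/-- A set with at most `μ` elements is contained in one that is closed under a given
`μ`-valued finitary operation. -/
theorem exists_closed_superset (hμ : ℵ₀ ≤ μ) (G : Finset T → Set T) (hG : ∀ E, #(G E) ≤ μ)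
    (C₀ : Set T) (hC₀ : #C₀ ≤ μ) :
    ∃ C : Set T, C₀ ⊆ C ∧ #C ≤ μ ∧ ∀ E : Finset T, (E : Set T) ⊆ C → G E ⊆ C := by
  classical
  let step : Set T → Set T := fun C =>
    C ∪ ⋃ E : Finset C, G (E.map (Function.Embedding.subtype _))
  let c : ℕ → Set T := fun n => step^[n] C₀
  have hstep : ∀ n, c (n + 1) = step (c n) := fun n => Function.iterate_succ_apply' _ _ _
  have hmono : Monotone c := monotone_nat_of_le_succ fun n => by
    rw [hstep]; exact Set.subset_union_left
  have hcard : ∀ n, #(c n) ≤ μ := by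
    intro n
    induction n with
    | zero => exact hC₀
    | succ n ih =>
      rw [hstep]
      exact mk_union_le_of_le hμ ih
        (mk_iUnion_le_of_le hμ (mk_finset_le_of_le hμ ih) fun E => hG _)
  refine ⟨⋃ n : ULift.{u} ℕ, c n.down, ?_, ?_, ?_⟩
  · exact Set.subset_iUnion (fun n : ULift.{u} ℕ => c n.down) ⟨0⟩
  · exact mk_iUnion_le_of_le hμ (by simpa using hμ) fun n => hcard _
  · intro E hE
    have : ∃ n, (E : Set T) ⊆ c n := by
      have hE' : ∀ t : E, ∃ n, t.1 ∈ c n := fun t => by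
        obtain ⟨n, hn⟩ := Set.mem_iUnion.1 (hE t.2)
        exact ⟨_, hn⟩
      choose m hm using hE'
      refine ⟨Finset.univ.sup m, fun t ht => ?_⟩
      exact hmono (Finset.le_sup (f := m) (Finset.mem_univ ⟨t, ht⟩)) (hm ⟨t, ht⟩)
    obtain ⟨n, hn⟩ := this
    refine subset_trans ?_ (Set.subset_iUnion (fun n : ULift.{u} ℕ => c n.down) ⟨n + 1⟩)
    change _ ⊆ c (n + 1)
    rw [hstep]
    refine subset_trans ?_ Set.subset_union_right
    refine subset_trans ?_ (Set.subset_iUnion _ (E.subtype (· ∈ c n)))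
    rw [Finset.subtype_map_of_mem fun t ht => hn ht]

theorem mk_le_of_mk_arrow_le {K : Type u} [SmallCategory K] (hK : #(Arrow K) ≤ μ) : #K ≤ μ :=
  (mk_le_of_injective (f := fun k : K => Arrow.mk (𝟙 k))
    fun _ _ h => congrArg (fun a : Arrow K => a.left) h).trans hK

end Cardinality

/-- The homomorphism underlying a morphism of the category of algebras. -/
abbrev Alg.toHom {L : FirstOrder.Language.{x, y}} {A B : Alg.{u} L} (f : A ⟶ B) : A →[L] B := f

/-- The `(∨,0)`-homomorphism underlying a morphism. -/
abbrev toSupBotHom {S T : SemilatSupCat.{u}} (f : S ⟶ T) : SupBotHom S T := f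

section Subfunctor

variable {L : FirstOrder.Language.{x, y}} {K : Type v} [Category.{w} K]

/-- The diagram of subalgebras given by a family of subalgebras that is closed under the
transition maps. -/
def subFunctor (B : K ⥤ Alg.{u} L) (C : ∀ k, L.Substructure (B.obj k)) [∀ k, Nonempty (C k)]
    (h : ∀ {k k'} (f : k ⟶ k'), ∀ c ∈ C k, Alg.toHom (B.map f) c ∈ C k') : K ⥤ Alg.{u} L where
  obj k := Alg.mk (C k)
  map {k k'} f := ((Alg.toHom (B.map f)).comp (C k).subtype.toHom).codRestrict (C k')
    fun c => h f c c.2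
  map_id k := by
    apply FirstOrder.Language.Hom.ext
    intro c
    apply Subtype.ext
    change Alg.toHom (B.map (𝟙 k)) c = c
    rw [B.map_id]
    rfl
  map_comp {k k' k''} f g := by
    apply FirstOrder.Language.Hom.ext
    intro c
    apply Subtype.ext
    change Alg.toHom (B.map (f ≫ g)) c = Alg.toHom (B.map g) (Alg.toHom (B.map f) c)
    rw [B.map_comp]
    rfl

variable [L.IsAlgebraic]

instance {A : Type u} [L.Structure A] [Nonempty A] (θ : Congr L A) : Nonempty θ.Quot :=
  ‹Nonempty A›.map θ.toQuot

/-- The diagram of quotients given by a compatible family of congruences. -/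
noncomputable def quotFunctor (B : K ⥤ Alg.{u} L) (θ : ∀ k, Congr L (B.obj k))
    (h : ∀ {k k'} (f : k ⟶ k') (a b : B.obj k), (θ k).Rel a b →
      (θ k').Rel (Alg.toHom (B.map f) a) (Alg.toHom (B.map f) b)) : K ⥤ Alg.{u} L where
  obj k := Alg.mk (θ k).Quot
  map {k k'} f := Congr.quotMap (θ k) (θ k') (Alg.toHom (B.map f)) (h f)
  map_id k := by
    apply FirstOrder.Language.Hom.ext
    intro c
    obtain ⟨c, rfl⟩ := (θ k).toQuot_surjective c
    change (θ k).toQuot (Alg.toHom (B.map (𝟙 k)) c) = (θ k).toQuot c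
    rw [B.map_id]
    rfl
  map_comp {k k' k''} f g := by
    apply FirstOrder.Language.Hom.ext
    intro c
    obtain ⟨c, rfl⟩ := (θ k).toQuot_surjective c
    change (θ k'').toQuot (Alg.toHom (B.map (f ≫ g)) c) =
      (θ k'').toQuot (Alg.toHom (B.map g) (Alg.toHom (B.map f) c))
    rw [B.map_comp]
    rfl

end Subfunctor

theorem exists_orderIso_of_le_iff {S : Type u} {T : Type v} {T' : Type w} [PartialOrder T]
    [PartialOrder T'] {p : S → T} {τ : S → T'} (hp : Function.Surjective p)
    (hτ : Function.Surjective τ) (h : ∀ a b, p a ≤ p b ↔ τ a ≤ τ b) :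
    ∃ e : T ≃o T', ∀ s, e (p s) = τ s := by
  let g := Function.surjInv hp
  have hg : ∀ t, p (g t) = t := Function.surjInv_eq hp
  have he : ∀ s, τ (g (p s)) = τ s := fun s =>
    le_antisymm ((h _ _).1 (hg _).le) ((h _ _).1 (hg _).ge)
  refine ⟨RelIso.ofSurjective (OrderEmbedding.ofMapLEIff (fun t => τ (g t)) fun a b => ?_) ?_, he⟩
  · rw [← h, hg, hg]
  · intro t
    obtain ⟨s, rfl⟩ := hτ t
    exact ⟨p s, he s⟩

theorem Conc.map_toQuot_le_iff {L : FirstOrder.Language.{x, y}} [L.IsAlgebraic] {A : Type u}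
    [L.Structure A] (θ : Congr L A) (α β : Conc L A) :
    Conc.map θ.toQuot α ≤ Conc.map θ.toQuot β ↔ α.1 ≤ Congr.gen (β.1.pairs ∪ θ.pairs) := by
  have hθ : Congr.ker (L := L) θ.toQuot = θ := Congr.ext' fun a b => Congr.toQuot_eq_toQuot
  constructor
  · intro h
    have := le_trans (Conc.map_le.1 h) (Congr.comap_map_le θ.toQuot_surjective β.1)
    rwa [hθ] at this
  · intro h
    refine Conc.map_le.2 (h.trans (Congr.gen_le.2 ?_))
    rintro p (hp | hp)
    · exact Conc.map_le.1 (le_refl (Conc.map θ.toQuot β).1) _ _ hp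
    · change (Conc.map (L := L) θ.toQuot β).1.Rel (θ.toQuot p.1) (θ.toQuot p.2)
      rw [Congr.toQuot_eq_toQuot.2 hp]
      exact Congr.rel_refl _ _

/-- A quotient of a diagram `C` lifts `E` if `Conc C` maps onto `E` in such a way that the
inequalities of `E` are those that hold modulo the congruences. -/
theorem exists_lifting_quotient {L : FirstOrder.Language.{x, y}} [L.IsAlgebraic] {K : Type v}
    [Category.{w} K] (C : K ⥤ Alg.{u} L) (θ : ∀ k, Congr L (C.obj k))
    (hθ : ∀ {k k'} (f : k ⟶ k') (a b : C.obj k), (θ k).Rel a b →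
      (θ k').Rel (Alg.toHom (C.map f) a) (Alg.toHom (C.map f) b))
    (E : K ⥤ SemilatSupCat.{u}) (τ : ∀ k, Conc L (C.obj k) → E.obj k)
    (hτ : ∀ k, Function.Surjective (τ k))
    (hnat : ∀ {k k'} (f : k ⟶ k') (α : Conc L (C.obj k)),
      τ k' (Conc.map (Alg.toHom (C.map f)) α) = toSupBotHom (E.map f) (τ k α))
    (hle : ∀ k (α β : Conc L (C.obj k)),
      τ k α ≤ τ k β ↔ α.1 ≤ Congr.gen (β.1.pairs ∪ (θ k).pairs)) :
    Nonempty (quotFunctor C θ hθ ⋙ concFunctor L ≅ E) := by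
  have h : ∀ k, ∃ e : Conc L (θ k).Quot ≃o E.obj k, ∀ α, e (Conc.map (θ k).toQuot α) = τ k α :=
    fun k => exists_orderIso_of_le_iff (Conc.map_surjective (θ k).toQuot_surjective) (hτ k)
      fun α β => by rw [Conc.map_toQuot_le_iff, hle]
  choose e he using h
  refine ⟨NatIso.ofComponents
    (fun k => SemilatSupCat.Iso.mk (α := SemilatSupCat.of (Conc L (θ k).Quot)) (e k)) ?_⟩
  intro k k' f
  apply SupBotHom.ext
  intro α
  obtain ⟨α, rfl⟩ := Conc.map_surjective (θ k).toQuot_surjective α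
  change e k' (Conc.map (Congr.quotMap (θ k) (θ k') (Alg.toHom (C.map f)) (hθ f))
    (Conc.map (θ k).toQuot α)) = toSupBotHom (E.map f) (e k (Conc.map (θ k).toQuot α))
  rw [he, ← hnat, ← he]
  congr 1
  apply Subtype.ext
  change Congr.map _ (Congr.map _ _) = Congr.map _ (Congr.map _ _)
  rw [← Congr.map_comp, ← Congr.map_comp]
  rfl

open Cardinal in
/-- Löwenheim–Skolem for diagrams of algebras with distinguished congruences: small families of
subsets are contained in small diagrams of subalgebras from which the order of the compact
congruences modulo the distinguished ones can be read off. -/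
theorem exists_subalgebras {L : FirstOrder.Language.{x, y}} {K : Type u} [SmallCategory K]
    (B : K ⥤ Alg.{u} L) {μ : Cardinal.{u}} (hμ : ℵ₀ ≤ μ) (hK : #(Arrow K) ≤ μ)
    (hB : ∀ k (S : L.Substructure (B.obj k)), S.FG → #S ≤ μ) (θ : ∀ k, Congr L (B.obj k))
    (C₀ : ∀ k, Set (B.obj k)) (hC₀ : ∀ k, #(C₀ k) ≤ μ) :
    ∃ C : ∀ k, L.Substructure (B.obj k), (∀ k, C₀ k ⊆ C k) ∧ (∀ k, Nonempty (C k)) ∧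
      (∀ k, #(C k) ≤ μ) ∧
      (∀ {k k'} (f : k ⟶ k'), ∀ c ∈ C k, Alg.toHom (B.map f) c ∈ C k') ∧
      ∀ k (α β : Conc L (C k)),
        (Conc.map (C k).subtype.toHom α).1 ≤
            Congr.gen ((Conc.map (C k).subtype.toHom β).1.pairs ∪ (θ k).pairs) ↔
          α.1 ≤ Congr.gen (β.1.pairs ∪ (Congr.comap (C k).subtype.toHom (θ k)).pairs) := by
  classical
  let T := Σ k, B.obj k
  have hKμ : #K ≤ μ := mk_le_of_mk_arrow_le hK
  let fib : Finset T → ∀ k, Finset (B.obj k) := fun E k =>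
    E.preimage (fun b => (⟨k, b⟩ : T)) fun _ _ _ _ h => sigma_mk_injective (β := fun k => (B.obj k).carrier) h
  have hfib : ∀ E k b, b ∈ fib E k ↔ (⟨k, b⟩ : T) ∈ E := fun E k b => Finset.mem_preimage
  have hw : ∀ k (c c' : B.obj k) (Q : Finset (B.obj k × B.obj k)), ∃ E : Finset (B.obj k),
      (Congr.gen (Q ∪ (θ k).pairs : Set (B.obj k × B.obj k)) : Congr L (B.obj k)).Rel c c' →
      ∀ C : L.Substructure (B.obj k), (E : Set (B.obj k)) ⊆ C → ∃ (ha : c ∈ C) (hb : c' ∈ C),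
      (Congr.gen {p : C × C | ((p.1 : B.obj k), (p.2 : B.obj k)) ∈
        (Q ∪ (θ k).pairs : Set (B.obj k × B.obj k))} : Congr L C).Rel ⟨c, ha⟩ ⟨c', hb⟩ := by
    intro k c c' Q
    by_cases h : (Congr.gen (Q ∪ (θ k).pairs : Set (B.obj k × B.obj k)) :
        Congr L (B.obj k)).Rel c c'
    · obtain ⟨E, hE⟩ := Congr.exists_finset_forall_substructure h
      exact ⟨E, fun _ => hE⟩
    · exact ⟨∅, fun h' => (h h').elim⟩
  choose w hw using hw
  let G₁ : Finset T → Set T := fun E => ⋃ k, Sigma.mk k ''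
    (FirstOrder.Language.Substructure.closure L (fib E k : Set (B.obj k)) : Set (B.obj k))
  let G₂ : Finset T → Set T := fun E => ⋃ f : Arrow K,
    (fun b => (⟨f.right, Alg.toHom (B.map f.hom) b⟩ : T)) '' (fib E f.left : Set (B.obj f.left))
  let G₃ : Finset T → Set T := fun E => ⋃ k, ⋃ c ∈ (fib E k : Set (B.obj k)),
    ⋃ c' ∈ (fib E k : Set (B.obj k)),
      ⋃ Q ∈ ((fib E k ×ˢ fib E k).powerset : Set (Finset (B.obj k × B.obj k))),
        Sigma.mk k '' (w k c c' Q : Set (B.obj k))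
  obtain ⟨D, hD₀, hDμ, hD⟩ := exists_closed_superset (T := T) hμ (fun E => G₁ E ∪ (G₂ E ∪ G₃ E))
    (by
      intro E
      refine mk_union_le_of_le hμ ?_ (mk_union_le_of_le hμ ?_ ?_)
      · refine mk_iUnion_le_of_le hμ hKμ fun k => mk_image_le.trans ?_
        exact hB k _ (FirstOrder.Language.Substructure.fg_closure (Finset.finite_toSet _))
      · exact mk_iUnion_le_of_le hμ hK fun f => mk_image_le.trans (mk_finset_coe_le hμ _)
      · refine mk_iUnion_le_of_le hμ hKμ fun k => ?_
        refine mk_biUnion_le_of_le hμ (mk_finset_coe_le hμ _) fun c _ => ?_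
        refine mk_biUnion_le_of_le hμ (mk_finset_coe_le hμ _) fun c' _ => ?_
        refine mk_biUnion_le_of_le hμ (mk_finset_coe_le hμ _) fun Q _ => ?_
        exact mk_image_le.trans (mk_finset_coe_le hμ _))
    (⋃ k, Sigma.mk k '' (C₀ k ∪ {Classical.arbitrary (B.obj k)}))
    (mk_iUnion_le_of_le hμ hKμ fun k => mk_image_le.trans
      (mk_union_le_of_le hμ (hC₀ k) (by simpa using one_le_aleph0.trans hμ)))
  have hD₁ : ∀ E : Finset T, (E : Set T) ⊆ D → G₁ E ⊆ D := fun E hE =>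
    subset_trans Set.subset_union_left (hD E hE)
  have hD₂ : ∀ E : Finset T, (E : Set T) ⊆ D → G₂ E ⊆ D := fun E hE =>
    subset_trans (subset_trans Set.subset_union_left Set.subset_union_right) (hD E hE)
  have hD₃ : ∀ E : Finset T, (E : Set T) ⊆ D → G₃ E ⊆ D := fun E hE =>
    subset_trans (subset_trans Set.subset_union_right Set.subset_union_right) (hD E hE)
  let C : ∀ k, L.Substructure (B.obj k) := fun k =>
    { carrier := {b | (⟨k, b⟩ : T) ∈ D}
      fun_mem := by
        intro n f a ha
        refine hD₁ (Finset.univ.image fun i => (⟨k, a i⟩ : T)) ?_ ?_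
        · intro t ht
          obtain ⟨i, -, rfl⟩ := Finset.mem_image.1 (Finset.mem_coe.1 ht)
          exact ha i
        · refine Set.mem_iUnion.2 ⟨k, _, ?_, rfl⟩
          refine FirstOrder.Language.Substructure.fun_mem _ f a fun i => ?_
          refine FirstOrder.Language.Substructure.subset_closure ?_
          exact (hfib _ _ _).2 (Finset.mem_image_of_mem _ (Finset.mem_univ i)) }
  have hC : ∀ k b, b ∈ C k ↔ (⟨k, b⟩ : T) ∈ D := fun _ _ => Iff.rfl
  refine ⟨C, ?_, ?_, ?_, ?_, ?_⟩
  · intro k b hb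
    exact hD₀ (Set.mem_iUnion.2 ⟨k, b, Or.inl hb, rfl⟩)
  · intro k
    exact ⟨⟨_, hD₀ (Set.mem_iUnion.2 ⟨k, _, Or.inr rfl, rfl⟩)⟩⟩
  · intro k
    refine le_trans (mk_le_of_injective (f := fun c : C k => (⟨⟨k, c.1⟩, c.2⟩ : D)) ?_) hDμ
    intro c c' h
    exact Subtype.ext (sigma_mk_injective (β := fun k => (B.obj k).carrier) (congrArg Subtype.val h))
  · intro k k' f c hc
    refine hD₂ {⟨k, c⟩} (by simpa using (hC k c).1 hc) ?_
    exact Set.mem_iUnion.2 ⟨Arrow.mk f, c, (hfib _ _ _).2 (by simp), rfl⟩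
  · intro k α β
    constructor
    · intro h
      obtain ⟨P, rfl⟩ := Conc.exists_eq_genF α
      obtain ⟨Q, rfl⟩ := Conc.exists_eq_genF β
      rw [Conc.map_genF, Conc.map_genF] at h
      set Q' := Q.image (Prod.map (C k).subtype.toHom (C k).subtype.toHom) with hQ'
      have h' : (Congr.gen ((Conc.genF Q' : Conc L (B.obj k)).1.pairs ∪ (θ k).pairs) :
          Congr L (B.obj k)) ≤ Congr.gen (Q' ∪ (θ k).pairs : Set (B.obj k × B.obj k)) := by
        refine Congr.gen_le.2 ?_
        rintro p (hp | hp)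
        · exact Congr.gen_mono (by simp) _ _ hp
        · exact Congr.rel_gen_of_mem (Or.inr hp)
      refine Congr.gen_le.2 fun p hp => ?_
      have hp' := h' _ _ (Congr.gen_le.1 h _ (Finset.mem_image_of_mem _ hp))
      have key := hw k p.1 p.2 Q' hp' (C k) ?_
      · obtain ⟨_, _, key⟩ := key
        refine Congr.gen_le.2 ?_ _ _ key
        rintro q (hq | hq)
        · obtain ⟨r, hr, hrq⟩ := Finset.mem_image.1 hq
          have : r = q := Prod.ext (Subtype.ext (congrArg Prod.fst hrq))
            (Subtype.ext (congrArg Prod.snd hrq))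
          subst this
          exact Congr.rel_gen_of_mem (Or.inl (Congr.rel_gen_of_mem hr))
        · exact Congr.rel_gen_of_mem (Or.inr hq)
      · let E : Finset T := (insert p Q).biUnion fun q => {⟨k, q.1.1⟩, ⟨k, q.2.1⟩}
        have hE : (E : Set T) ⊆ D := by
          intro t ht
          obtain ⟨q, -, hq⟩ := Finset.mem_biUnion.1 (Finset.mem_coe.1 ht)
          rw [Finset.mem_insert, Finset.mem_singleton] at hq
          rcases hq with rfl | rfl
          · exact q.1.2
          · exact q.2.2
        have hE₁ : ∀ q ∈ insert p Q, q.1.1 ∈ fib E k := fun q hq =>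
          (hfib _ _ _).2 (Finset.mem_biUnion.2 ⟨q, hq, by simp⟩)
        have hE₂ : ∀ q ∈ insert p Q, q.2.1 ∈ fib E k := fun q hq =>
          (hfib _ _ _).2 (Finset.mem_biUnion.2 ⟨q, hq, by simp⟩)
        intro b hb
        refine hD₃ E hE ?_
        refine Set.mem_iUnion.2 ⟨k, Set.mem_biUnion (hE₁ p (by simp))
          (Set.mem_biUnion (hE₂ p (by simp)) (Set.mem_biUnion (x := Q') ?_ ⟨b, hb, rfl⟩))⟩
        refine Finset.mem_coe.2 (Finset.mem_powerset.2 fun q hq => ?_)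
        obtain ⟨r, hr, rfl⟩ := Finset.mem_image.1 hq
        exact Finset.mem_product.2
          ⟨hE₁ r (Finset.mem_insert_of_mem hr), hE₂ r (Finset.mem_insert_of_mem hr)⟩
    · intro h
      refine Conc.map_le.2 (h.trans (Congr.gen_le.2 ?_))
      rintro p (hp | hp)
      · exact Congr.rel_gen_of_mem (Or.inl (Conc.map_le.1 (le_refl (Conc.map _ β).1) _ _ hp))
      · exact Congr.rel_gen_of_mem (Or.inr hp)

open scoped CategoryTheory.Prod

theorem Alg.map_map_apply {L : FirstOrder.Language.{x, y}} {K : Type v} [Category.{w} K]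
    (B : K ⥤ Alg.{u} L) {k k' k'' : K} (f : k ⟶ k') (g : k' ⟶ k'') (a : B.obj k) :
    Alg.toHom (B.map g) (Alg.toHom (B.map f) a) = Alg.toHom (B.map (f ≫ g)) a := by
  rw [B.map_comp]
  rfl

theorem Alg.map_id_apply {L : FirstOrder.Language.{x, y}} {K : Type v} [Category.{w} K]
    (B : K ⥤ Alg.{u} L) (k : K) (a : B.obj k) : Alg.toHom (B.map (𝟙 k)) a = a := by
  rw [B.map_id]
  rfl

open Cardinal FirstOrder.Language.Substructure in
theorem mk_closure_le_of_le {L : FirstOrder.Language.{x, y}} {A : Type u} [L.Structure A]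
    {μ : Cardinal.{u}} (hμ : ℵ₀ ≤ μ) (hA : ∀ S : L.Substructure A, S.FG → #S ≤ μ) {s : Set A}
    (hs : #s ≤ μ) : #(closure L s) ≤ μ := by
  classical
  have h : (closure L s : Set A) ⊆ ⋃ E : Finset s, (closure L (Subtype.val '' (E : Set s)) : Set A) := by
    intro a ha
    refine closure_induction (p := fun a => a ∈ ⋃ E : Finset s,
      (closure L (Subtype.val '' (E : Set s)) : Set A)) ha ?_ ?_
    · intro b hb
      refine Set.mem_iUnion.2 ⟨{⟨b, hb⟩}, subset_closure ?_⟩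
      simp
    · intro n f b hb
      have hb' : ∀ i, ∃ E : Finset s, b i ∈ closure L (Subtype.val '' (E : Set s)) :=
        fun i => Set.mem_iUnion.1 (hb i)
      choose E hE using hb'
      refine Set.mem_iUnion.2 ⟨Finset.univ.biUnion E, fun_mem _ f b fun i => ?_⟩
      refine closure_mono (Set.image_mono ?_) (hE i)
      exact_mod_cast Finset.subset_biUnion_of_mem E (Finset.mem_univ i)
  refine (mk_le_mk_of_subset h).trans (mk_iUnion_le_of_le hμ (mk_finset_le_of_le hμ hs) fun E => ?_)
  exact hA _ (fg_closure ((Finset.finite_toSet E).image _))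

/-- A point of a poset labelled by a map from its principal lower subset. -/
abbrev LabelledPoint (I : Type u) [PartialOrder I] (Ξ : Type u) : Type u :=
  Σ i : I, {l : I // l ≤ i} → Ξ

/-- The labelled point lying below a given one over a smaller element. -/
abbrev LabelledPoint.restrict {I : Type u} [PartialOrder I] {Ξ : Type u} (z : LabelledPoint I Ξ)
    {l : I} (h : l ≤ z.1) : LabelledPoint I Ξ :=
  ⟨l, fun m => z.2 ⟨m, m.2.trans h⟩⟩

section Condensate

variable {L : FirstOrder.Language.{x, y}} {I : Type u} [PartialOrder I]
  {J : Type u} [SmallCategory J] (𝒜 : I × J ⥤ Alg.{u} L) (Ξ : Type u)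

/-- The transition map of a diagram along the first coordinate. -/
abbrev trans₁ {i k : I} (h : i ≤ k) (j : J) : 𝒜.obj (i, j) →[L] 𝒜.obj (k, j) :=
  Alg.toHom (𝒜.map (homOfLE h ×ₘ 𝟙 j))

/-- The transition map of a diagram along the second coordinate. -/
abbrev trans₂ (i : I) {j j' : J} (f : j ⟶ j') : 𝒜.obj (i, j) →[L] 𝒜.obj (i, j') :=
  Alg.toHom (𝒜.map (𝟙 i ×ₘ f))

theorem trans₁_trans₁ {i k l : I} (h : i ≤ k) (h' : k ≤ l) (j : J) (a : 𝒜.obj (i, j)) :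
    trans₁ 𝒜 h' j (trans₁ 𝒜 h j a) = trans₁ 𝒜 (h.trans h') j a := by
  rw [trans₁, trans₁, Alg.map_map_apply]
  refine congrArg (fun f => Alg.toHom (𝒜.map f) a) (Prod.hom_ext (Subsingleton.elim _ _) ?_)
  exact Category.comp_id _

theorem trans₁_refl {i : I} (h : i ≤ i) (j : J) (a : 𝒜.obj (i, j)) :
    trans₁ 𝒜 h j a = a :=
  Alg.map_id_apply 𝒜 (i, j) a

theorem trans₂_trans₁ {i k : I} (h : i ≤ k) {j j' : J} (f : j ⟶ j') (a : 𝒜.obj (i, j)) :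
    trans₂ 𝒜 k f (trans₁ 𝒜 h j a) = trans₁ 𝒜 h j' (trans₂ 𝒜 i f a) := by
  rw [trans₁, trans₂, Alg.map_map_apply, Alg.map_map_apply]
  refine congrArg (fun f => Alg.toHom (𝒜.map f) a) (Prod.hom_ext (Subsingleton.elim _ _) ?_)
  exact ((Category.id_comp _).trans (Category.comp_id _).symm)

variable [L.IsAlgebraic]

/-- The diagram of the products over all labelled points. -/
def labelledProduct : J ⥤ Alg.{u} L where
  obj j := Alg.mk (∀ z : LabelledPoint I Ξ, 𝒜.obj (z.1, j))
  map {j j'} f :=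
    { toFun := fun a z => trans₂ 𝒜 z.1 f (a z)
      map_fun' := fun g a => funext fun z => (trans₂ 𝒜 z.1 f).map_fun g _
      map_rel' := fun r _ _ => isEmptyElim r }
  map_id j := by
    apply FirstOrder.Language.Hom.ext
    intro a
    funext z
    exact Alg.map_id_apply 𝒜 (z.1, j) _
  map_comp {j j' j''} f g := by
    apply FirstOrder.Language.Hom.ext
    intro a
    funext z
    change trans₂ 𝒜 z.1 (f ≫ g) (a z) = trans₂ 𝒜 z.1 g (trans₂ 𝒜 z.1 f (a z))
    rw [trans₂, trans₂, trans₂, Alg.map_map_apply]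
    congr 2

variable {Ξ}

open Classical in
/-- The element of the product that takes values coming from `a` at the labelled points above `i`
with label `ξ` at `i`, and values coming from `a₀` elsewhere. -/
noncomputable def condensateGen {b : I} (hb : ∀ i, b ≤ i) (j : J) {i : I} (ξ : Ξ)
    (a : 𝒜.obj (i, j)) (a₀ : 𝒜.obj (b, j)) : (labelledProduct 𝒜 Ξ).obj j := fun z =>
  if h : ∃ h : i ≤ z.1, z.2 ⟨i, h⟩ = ξ then trans₁ 𝒜 h.1 j a else trans₁ 𝒜 (hb z.1) j a₀

theorem condensateGen_of_label {b : I} (hb : ∀ i, b ≤ i) (j : J) {i : I} {ξ : Ξ}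
    (a : 𝒜.obj (i, j)) (a₀ : 𝒜.obj (b, j)) {z : LabelledPoint I Ξ} (h : i ≤ z.1)
    (hz : z.2 ⟨i, h⟩ = ξ) : condensateGen 𝒜 hb j ξ a a₀ z = trans₁ 𝒜 h j a :=
  dif_pos ⟨h, hz⟩

theorem condensateGen_of_not_label {b : I} (hb : ∀ i, b ≤ i) (j : J) {i : I} {ξ : Ξ}
    (a : 𝒜.obj (i, j)) (a₀ : 𝒜.obj (b, j)) {z : LabelledPoint I Ξ}
    (hz : ¬ ∃ h : i ≤ z.1, z.2 ⟨i, h⟩ = ξ) :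
    condensateGen 𝒜 hb j ξ a a₀ z = trans₁ 𝒜 (hb z.1) j a₀ :=
  dif_neg hz

theorem labelledProduct_map_condensateGen {b : I} (hb : ∀ i, b ≤ i) {j j' : J} (f : j ⟶ j')
    {i : I} (ξ : Ξ) (a : 𝒜.obj (i, j)) (a₀ : 𝒜.obj (b, j)) :
    Alg.toHom ((labelledProduct 𝒜 Ξ).map f) (condensateGen 𝒜 hb j ξ a a₀) =
      condensateGen 𝒜 hb j' ξ (trans₂ 𝒜 i f a) (trans₂ 𝒜 b f a₀) := by
  funext z
  change trans₂ 𝒜 z.1 f (condensateGen 𝒜 hb j ξ a a₀ z) = _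
  by_cases h : ∃ h : i ≤ z.1, z.2 ⟨i, h⟩ = ξ
  · rw [condensateGen_of_label 𝒜 hb j a a₀ h.1 h.2, condensateGen_of_label 𝒜 hb j' _ _ h.1 h.2,
      trans₂_trans₁]
  · rw [condensateGen_of_not_label 𝒜 hb j a a₀ h, condensateGen_of_not_label 𝒜 hb j' _ _ h,
      trans₂_trans₁]

/-- An element of the product is coherent off `F` if its values are transported along every
interval of labelled points that avoids `F`. -/
def CoherentOff {j : J} (a : (labelledProduct 𝒜 Ξ).obj j) (F : Finset (I × Ξ)) : Prop :=
  ∀ (z : LabelledPoint I Ξ) (l : I) (h : l ≤ z.1),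
    (∀ (m : I) (hm : m ≤ z.1), l < m → (m, z.2 ⟨m, hm⟩) ∉ F) →
      a z = trans₁ 𝒜 h j (a (z.restrict h))

variable {𝒜}

theorem CoherentOff.mono {j : J} {a : (labelledProduct 𝒜 Ξ).obj j} {F F' : Finset (I × Ξ)}
    (h : CoherentOff 𝒜 a F) (hF : F ⊆ F') : CoherentOff 𝒜 a F' :=
  fun z l hl hm => h z l hl fun m hmz hlm hF' => hm m hmz hlm (hF hF')

theorem coherentOff_condensateGen (hI : IsWellFoundedTree I) {b : I} (hb : ∀ i, b ≤ i) (j : J)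
    {i : I} (ξ : Ξ) (a : 𝒜.obj (i, j)) (a₀ : 𝒜.obj (b, j)) :
    CoherentOff 𝒜 (condensateGen 𝒜 hb j ξ a a₀) {(i, ξ)} := by
  intro z l hl hm
  by_cases h : ∃ h : i ≤ z.1, z.2 ⟨i, h⟩ = ξ
  · obtain ⟨h, hz⟩ := h
    have hil : i ≤ l := by
      rcases (hI.isChain_Iic z.1).total h hl with h' | h'
      · exact h'
      · rcases h'.eq_or_lt with rfl | h'
        · exact le_rfl
        · exact (hm i h h' (by rw [hz]; simp)).elim
    rw [condensateGen_of_label 𝒜 hb j a a₀ h hz,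
      condensateGen_of_label 𝒜 hb j a a₀ (z := z.restrict hl) hil hz]
    exact (trans₁_trans₁ 𝒜 hil hl j a).symm
  · rw [condensateGen_of_not_label 𝒜 hb j a a₀ h,
      condensateGen_of_not_label 𝒜 hb j a a₀ (z := z.restrict hl)]
    · exact (trans₁_trans₁ 𝒜 (hb l) hl j a₀).symm
    · rintro ⟨h', hz'⟩
      exact h ⟨h'.trans hl, hz'⟩

theorem exists_coherentOff_funMap {j : J} {n : ℕ} (f : L.Functions n)
    (a : Fin n → (labelledProduct 𝒜 Ξ).obj j) (h : ∀ i, ∃ F, CoherentOff 𝒜 (a i) F) :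
    ∃ F, CoherentOff 𝒜 (FirstOrder.Language.Structure.funMap f a) F := by
  classical
  choose F hF using h
  refine ⟨Finset.univ.biUnion F, fun z l hl hm => ?_⟩
  change FirstOrder.Language.Structure.funMap f (fun i => a i z) =
    trans₁ 𝒜 hl j (FirstOrder.Language.Structure.funMap f fun i => a i (z.restrict hl))
  refine Eq.trans ?_ ((trans₁ 𝒜 hl j).map_fun f fun i => a i (z.restrict hl)).symm
  congr 1
  funext i
  exact (hF i).mono (Finset.subset_biUnion_of_mem F (Finset.mem_univ i)) z l hl hm

open Cardinal FirstOrder.Language.Substructure in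
/-- A diagram over the product of a tree and `J` is approximated by the projections of a diagram
over `J`. -/
theorem exists_condensate (hI : IsWellFoundedTree I) (𝒜 : I × J ⥤ Alg.{u} L) (Ξ : Type u)
    (V : ObjectProperty (Alg.{u} L)) (hV : IsVariety V) {μ : Cardinal.{u}} (hμ : ℵ₀ ≤ μ)
    (hloc : LocallyLE V μ) (hIμ : #I ≤ μ) (hΞ : #Ξ ≤ μ) [Nonempty Ξ] (hA : ∀ p, #(𝒜.obj p) ≤ μ)
    (h𝒜 : ∀ p, V (𝒜.obj p)) :
    ∃ (𝒞 : J ⥤ Alg.{u} L), (∀ j, V (𝒞.obj j)) ∧ (∀ j, #(𝒞.obj j) ≤ μ) ∧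
      ∃ π : ∀ (z : LabelledPoint I Ξ) (j : J), 𝒞.obj j →[L] 𝒜.obj (z.1, j),
        (∀ z j, Function.Surjective (π z j)) ∧
        (∀ z {j j' : J} (f : j ⟶ j') (a : 𝒞.obj j),
          π z j' (Alg.toHom (𝒞.map f) a) = trans₂ 𝒜 z.1 f (π z j a)) ∧
        (∀ j (a : 𝒞.obj j), ∃ F : Finset (I × Ξ), ∀ (z : LabelledPoint I Ξ) (l : I)
          (h : l ≤ z.1), (∀ (m : I) (hm : m ≤ z.1), l < m → (m, z.2 ⟨m, hm⟩) ∉ F) →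
            π z j a = trans₁ 𝒜 h j (π (z.restrict h) j a)) := by
  classical
  obtain ⟨b, hb⟩ := hI.exists_least
  let P := labelledProduct 𝒜 Ξ
  let gen : ∀ j, (Σ i : I, Ξ × 𝒜.obj (i, j) × 𝒜.obj (b, j)) → P.obj j := fun j g =>
    condensateGen 𝒜 hb j g.2.1 g.2.2.1 g.2.2.2
  let S : ∀ j, L.Substructure (P.obj j) := fun j => closure L (Set.range (gen j))
  have hgen : ∀ j g, gen j g ∈ S j := fun j g => subset_closure (Set.mem_range_self g)
  have : ∀ j, Nonempty (S j) := fun j => ⟨⟨_, hgen j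
    ⟨b, Classical.arbitrary Ξ, Classical.arbitrary (𝒜.obj (b, j)),
      Classical.arbitrary (𝒜.obj (b, j))⟩⟩⟩
  have hS : ∀ {j j' : J} (f : j ⟶ j'), ∀ c ∈ S j, Alg.toHom (P.map f) c ∈ S j' := by
    intro j j' f c hc
    have : S j ≤ (S j').comap (Alg.toHom (P.map f)) := by
      refine closure_le.2 ?_
      rintro _ ⟨⟨i, ξ, a, a₀⟩, rfl⟩
      change Alg.toHom (P.map f) (condensateGen 𝒜 hb j ξ a a₀) ∈ S j'
      rw [labelledProduct_map_condensateGen]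
      exact hgen j' ⟨i, ξ, trans₂ 𝒜 i f a, trans₂ 𝒜 b f a₀⟩
    exact this hc
  have hVP : ∀ j, V (P.obj j) := fun j => hV.prod _ _ fun z => h𝒜 (z.1, j)
  refine ⟨subFunctor P S hS, fun j => hV.sub _ _ (hVP j), fun j => ?_,
    fun z j => ⟨fun c => c.1 z, fun f a => rfl, fun r _ _ => isEmptyElim r⟩, ?_, ?_, ?_⟩
  · refine mk_closure_le_of_le hμ (fun T hT => hloc _ (hVP j) T hT) (mk_range_le.trans ?_)
    exact mk_sigma_le_of_le hμ hIμ fun i =>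
      mk_prod_le_of_le hμ hΞ (mk_prod_le_of_le hμ (hA _) (hA _))
  · intro z j a
    refine ⟨⟨gen j ⟨z.1, z.2 ⟨z.1, le_rfl⟩, a, Classical.arbitrary _⟩, hgen _ _⟩, ?_⟩
    exact (condensateGen_of_label 𝒜 hb j a _ le_rfl rfl).trans (trans₁_refl 𝒜 _ j a)
  · intro z j j' f a
    rfl
  · intro j a
    refine closure_induction (p := fun a => ∃ F, CoherentOff 𝒜 a F) a.2 ?_ ?_
    · rintro _ ⟨⟨i, ξ, a, a₀⟩, rfl⟩
      exact ⟨_, coherentOff_condensateGen hI hb j ξ a a₀⟩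
    · intro n f a ha
      exact exists_coherentOff_funMap f a ha

end Condensate

section HasLifting

variable {L : FirstOrder.Language.{x, y}} {V : ObjectProperty (Alg.{u} L)} {J : Type v}
  [Category.{w} J]

theorem hasLifting_iff {D : J ⥤ SemilatSupCat.{u}} :
    HasLifting V D ↔
      ∃ 𝒜 : J ⥤ Alg.{u} L, (∀ j, V (𝒜.obj j)) ∧ Nonempty (𝒜 ⋙ concFunctor L ≅ D) :=
  ⟨fun ⟨𝒜, h⟩ => ⟨𝒜 ⋙ V.ι, fun j => (𝒜.obj j).property, h⟩,
    fun ⟨𝒜, h, e⟩ => ⟨V.lift 𝒜 h, e⟩⟩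

theorem HasLifting.comp {D : J ⥤ SemilatSupCat.{u}} (h : HasLifting V D) {K : Type x₁}
    [Category.{y₁} K] (F : K ⥤ J) : HasLifting V (F ⋙ D) := by
  obtain ⟨𝒜, ⟨e⟩⟩ := h
  exact ⟨F ⋙ 𝒜, ⟨Functor.isoWhiskerLeft F e⟩⟩

theorem HasLifting.of_iso {D D' : J ⥤ SemilatSupCat.{u}} (h : HasLifting V D) (e : D ≅ D') :
    HasLifting V D' := by
  obtain ⟨𝒜, ⟨e'⟩⟩ := h
  exact ⟨𝒜, ⟨e' ≪≫ e⟩⟩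

end HasLifting

/-- The order isomorphism underlying an isomorphism of `(∨,0)`-semilattices. -/
def orderIsoOfIso {S T : SemilatSupCat.{u}} (e : S ≅ T) : S ≃o T where
  toFun := toSupBotHom e.hom
  invFun := toSupBotHom e.inv
  left_inv s := DFunLike.congr_fun (F := SupBotHom S S) e.hom_inv_id s
  right_inv s := DFunLike.congr_fun (F := SupBotHom T T) e.inv_hom_id s
  map_rel_iff' {a b} := by
    refine ⟨fun h => ?_, fun h => OrderHomClass.mono (toSupBotHom e.hom) h⟩
    have := OrderHomClass.mono (toSupBotHom e.inv) h
    have h' : ∀ s, toSupBotHom e.inv (toSupBotHom e.hom s) = s := fun s =>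
      DFunLike.congr_fun (F := SupBotHom S S) e.hom_inv_id s
    change toSupBotHom e.inv (toSupBotHom e.hom a) ≤ toSupBotHom e.inv (toSupBotHom e.hom b) at this
    rwa [h', h'] at this

namespace Conc

variable {L : FirstOrder.Language.{x, y}} {A : Type u} {B : Type v} {C : Type w} [L.Structure A]
  [L.Structure B] [L.Structure C]

theorem map_comp_apply (g : B →[L] C) (f : A →[L] B) (α : Conc L A) :
    map (g.comp f) α = map g (map f α) :=
  Subtype.ext (Congr.map_comp g f α.1)

open Cardinal in
theorem mk_le_of_le {μ : Cardinal.{u}} (hμ : ℵ₀ ≤ μ) (hA : #A ≤ μ) : #(Conc L A) ≤ μ := by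
  refine le_trans (mk_le_of_surjective (f := fun P : Finset (A × A) => (genF P : Conc L A)) ?_)
    (mk_finset_le_of_le hμ (mk_prod_le_of_le hμ hA hA))
  intro α
  obtain ⟨P, rfl⟩ := exists_eq_genF α
  exact ⟨P, rfl⟩

theorem exists_map_subtype_eq_genF {S : L.Substructure A} {P : Finset (A × A)}
    (hP : ∀ p ∈ P, p.1 ∈ S ∧ p.2 ∈ S) : ∃ α : Conc L S, map S.subtype.toHom α = genF P := by
  classical
  refine ⟨genF (P.attach.image fun p => (⟨p.1.1, (hP _ p.2).1⟩, ⟨p.1.2, (hP _ p.2).2⟩)), ?_⟩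
  rw [map_genF, Finset.image_image]
  congr 1
  exact Finset.attach_image_val

open Cardinal in
/-- A surjection from the compact congruences of an algebra onto a small semilattice stays
surjective on suitable small subalgebras. -/
theorem exists_set_forall_surjective {μ : Cardinal.{u}} (hμ : ℵ₀ ≤ μ) {S : Type u} (hS : #S ≤ μ)
    {σ : Conc L A → S} (hσ : Function.Surjective σ) :
    ∃ s : Set A, #s ≤ μ ∧ ∀ T : L.Substructure A, s ⊆ T →
      Function.Surjective fun α : Conc L T => σ (map T.subtype.toHom α) := by
  classical
  have : ∀ t : S, ∃ P : Finset (A × A), σ (genF P) = t := fun t => by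
    obtain ⟨α, rfl⟩ := hσ t
    obtain ⟨P, rfl⟩ := exists_eq_genF α
    exact ⟨P, rfl⟩
  choose P hP using this
  refine ⟨⋃ t, ((P t).image Prod.fst ∪ (P t).image Prod.snd : Finset A),
    mk_iUnion_le_of_le hμ hS fun t => mk_finset_coe_le hμ _, fun T hT t => ?_⟩
  have hT' : (((P t).image Prod.fst ∪ (P t).image Prod.snd : Finset A) : Set A) ⊆ T :=
    subset_trans (Set.subset_iUnion
      (fun t => (((P t).image Prod.fst ∪ (P t).image Prod.snd : Finset A) : Set A)) t) hT
  obtain ⟨α, hα⟩ := exists_map_subtype_eq_genF (S := T) (P := P t) fun p hp =>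
    ⟨hT' (Finset.mem_coe.2 (Finset.mem_union_left _ (Finset.mem_image_of_mem _ hp))),
      hT' (Finset.mem_coe.2 (Finset.mem_union_right _ (Finset.mem_image_of_mem _ hp)))⟩
  exact ⟨α, by simp only [hα, hP]⟩

theorem comap_congrLE {S : Type x₁} [SemilatticeSup S] [OrderBot S] (f : A →[L] B)
    (σ : SupBotHom (Conc L B) S) (s : S) :
    Congr.comap f (congrLE σ s) = congrLE (σ.comp (mapHom f)) s := by
  apply Congr.ext'
  intro a b
  change σ (principal (f a) (f b)) ≤ s ↔ σ (map f (principal a b)) ≤ s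
  rw [map_principal]

/-- A `(∨,0)`-homomorphism that is, up to isomorphism, a quotient by an ideal. -/
structure IsIdealQuotient {S : Type x₁} [SemilatticeSup S] [OrderBot S]
    (σ : SupBotHom (Conc L A) S) : Prop where
  surjective : Function.Surjective σ
  exists_le_sup : ∀ α β, σ α ≤ σ β → ∃ γ, σ γ = ⊥ ∧ α ≤ β ⊔ γ

end Conc

theorem map_subtype_map_subFunctor {L : FirstOrder.Language.{x, y}} {K : Type v} [Category.{w} K]
    (B : K ⥤ Alg.{u} L) (C : ∀ k, L.Substructure (B.obj k)) [∀ k, Nonempty (C k)]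
    (h : ∀ {k k'} (f : k ⟶ k'), ∀ c ∈ C k, Alg.toHom (B.map f) c ∈ C k') {k k' : K} (f : k ⟶ k')
    (α : Conc L (C k)) :
    Conc.map (C k').subtype.toHom (Conc.map (Alg.toHom ((subFunctor B C h).map f)) α) =
      Conc.map (Alg.toHom (B.map f)) (Conc.map (C k).subtype.toHom α) := by
  rw [← Conc.map_comp_apply]
  exact (Conc.map_comp_apply (A := C k) (B := C k') _ _ α).symm

/-- A quotient of a diagram `C` lifts `E` if `Conc C` maps onto `E` in such a way that the
inequalities of `E` are those that hold modulo the congruences which are collapsed. -/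
theorem hasLifting_of_surjective {L : FirstOrder.Language.{x, y}} [L.IsAlgebraic]
    {V : ObjectProperty (Alg.{u} L)} (hV : IsVariety V) {K : Type v} [Category.{w} K]
    (C : K ⥤ Alg.{u} L) (hC : ∀ k, V (C.obj k)) (E : K ⥤ SemilatSupCat.{u})
    (τ : ∀ k, SupBotHom (Conc L (C.obj k)) (E.obj k)) (hτ : ∀ k, Function.Surjective (τ k))
    (hnat : ∀ {k k'} (f : k ⟶ k') (α : Conc L (C.obj k)),
      τ k' (Conc.map (Alg.toHom (C.map f)) α) = toSupBotHom (E.map f) (τ k α))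
    (hle : ∀ k (α β : Conc L (C.obj k)), τ k α ≤ τ k β ↔
      α.1 ≤ Congr.gen (β.1.pairs ∪ (Conc.congrLE (τ k) ⊥).pairs)) :
    ∃ 𝒜 : K ⥤ Alg.{u} L, (∀ k, V (𝒜.obj k)) ∧
      (∀ k, Cardinal.mk (𝒜.obj k) ≤ Cardinal.mk (C.obj k)) ∧
      Nonempty (𝒜 ⋙ concFunctor L ≅ E) := by
  have hcompat : ∀ {k k'} (f : k ⟶ k') (a b : C.obj k), (Conc.congrLE (τ k) ⊥).Rel a b →
      (Conc.congrLE (τ k') ⊥).Rel (Alg.toHom (C.map f) a) (Alg.toHom (C.map f) b) := by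
    intro k k' f a b hab
    change τ k' (Conc.principal (Alg.toHom (C.map f) a) (Alg.toHom (C.map f) b)) ≤ ⊥
    have hab' : τ k (Conc.principal a b) = ⊥ := le_bot_iff.1 hab
    rw [← Conc.map_principal, hnat, hab', map_bot]
  refine ⟨quotFunctor C (fun k => Conc.congrLE (τ k) ⊥) hcompat, ?_, ?_,
    exists_lifting_quotient C _ hcompat E (fun k => τ k) hτ hnat hle⟩
  · exact fun k => hV.image _ (Alg.mk _) _ (Congr.toQuot_surjective _) (hC k)
  · exact fun k => Cardinal.mk_le_of_surjective (Congr.toQuot_surjective (Conc.congrLE (τ k) ⊥))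

open Cardinal in
theorem exists_subalgebras_of_isIdealQuotient {L : FirstOrder.Language.{x, y}} {K : Type u}
    [SmallCategory K] (B : K ⥤ Alg.{u} L) {μ : Cardinal.{u}} (hμ : ℵ₀ ≤ μ)
    (hK : #(Arrow K) ≤ μ) (hB : ∀ k (S : L.Substructure (B.obj k)), S.FG → #S ≤ μ)
    (E : K → SemilatSupCat.{u}) (hE : ∀ k, #(E k) ≤ μ)
    (σ : ∀ k, SupBotHom (Conc L (B.obj k)) (E k)) (hσ : ∀ k, Conc.IsIdealQuotient (σ k))
    (C₀ : ∀ k, Set (B.obj k)) (hC₀ : ∀ k, #(C₀ k) ≤ μ) :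
    ∃ C : ∀ k, L.Substructure (B.obj k), (∀ k, C₀ k ⊆ C k) ∧ (∀ k, Nonempty (C k)) ∧
      (∀ k, #(C k) ≤ μ) ∧
      (∀ {k k'} (f : k ⟶ k'), ∀ c ∈ C k, Alg.toHom (B.map f) c ∈ C k') ∧
      (∀ k, Function.Surjective ((σ k).comp (Conc.mapHom (C k).subtype.toHom))) ∧
      ∀ k (α β : Conc L (C k)),
        (σ k).comp (Conc.mapHom (C k).subtype.toHom) α ≤
            (σ k).comp (Conc.mapHom (C k).subtype.toHom) β ↔
          α.1 ≤ Congr.gen (β.1.pairs ∪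
            (Conc.congrLE ((σ k).comp (Conc.mapHom (C k).subtype.toHom)) ⊥).pairs) := by
  choose s hs hsurj using fun k => Conc.exists_set_forall_surjective hμ (hE k) (hσ k).surjective
  obtain ⟨C, hC₁, hC₂, hC₃, hC₄, hC₅⟩ := exists_subalgebras B hμ hK hB
    (fun k => Conc.congrLE (σ k) ⊥) (fun k => C₀ k ∪ s k)
    fun k => mk_union_le_of_le hμ (hC₀ k) (hs k)
  refine ⟨C, fun k => subset_trans Set.subset_union_left (hC₁ k), hC₂, hC₃, hC₄,
    fun k => hsurj k (C k) (subset_trans Set.subset_union_right (hC₁ k)), fun k α β => ?_⟩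
  rw [← Conc.comap_congrLE, ← hC₅]
  exact Conc.apply_le_apply_iff (hσ k).exists_le_sup

open Cardinal in
/-- A lifting of a small diagram can be chosen small. -/
theorem HasLifting.exists_mk_le {L : FirstOrder.Language.{x, y}} [L.IsAlgebraic]
    {V : ObjectProperty (Alg.{u} L)} (hV : IsVariety V) {K : Type u} [SmallCategory K]
    {μ : Cardinal.{u}} (hμ : ℵ₀ ≤ μ) (hK : #(Arrow K) ≤ μ) (hloc : LocallyLE V μ)
    {D : K ⥤ SemilatSupCat.{u}} (hD : ∀ k, #(D.obj k) ≤ μ) (h : HasLifting V D) :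
    ∃ 𝒜 : K ⥤ Alg.{u} L, (∀ k, V (𝒜.obj k)) ∧ (∀ k, #(𝒜.obj k) ≤ μ) ∧
      Nonempty (𝒜 ⋙ concFunctor L ≅ D) := by
  obtain ⟨B, hB, ⟨e⟩⟩ := hasLifting_iff.1 h
  let σ : ∀ k, SupBotHom (Conc L (B.obj k)) (D.obj k) := fun k => e.hom.app k
  have hσ : ∀ k, Conc.IsIdealQuotient (σ k) := fun k =>
    ⟨(orderIsoOfIso (e.app k)).surjective, fun α β h =>
      ⟨⊥, map_bot _, le_trans ((orderIsoOfIso (e.app k)).le_iff_le.1 h) le_sup_left⟩⟩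
  obtain ⟨C, -, hC₂, hC₃, hC₄, hC₅, hC₆⟩ := exists_subalgebras_of_isIdealQuotient B hμ hK
    (fun k S hS => hloc _ (hB k) S hS) D.obj hD σ hσ (fun _ => ∅) (fun k => by simp)
  have hnat : ∀ {k k'} (f : k ⟶ k') (α : Conc L (C k)),
      (σ k').comp (Conc.mapHom (C k').subtype.toHom)
          (Conc.map (Alg.toHom ((subFunctor B C hC₄).map f)) α) =
        toSupBotHom (D.map f) ((σ k).comp (Conc.mapHom (C k).subtype.toHom) α) := by
    intro k k' f α
    exact (congrArg (σ k') (map_subtype_map_subFunctor B C hC₄ f α)).trans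
      (DFunLike.congr_fun (F := SupBotHom (Conc L (B.obj k)) (D.obj k'))
        (e.hom.naturality f) (Conc.map (C k).subtype.toHom α))
  obtain ⟨𝒜, h₁, h₂, h₃⟩ := hasLifting_of_surjective hV (subFunctor B C hC₄)
    (fun k => hV.sub _ _ (hB k)) D _ hC₅ hnat hC₆
  exact ⟨𝒜, h₁, fun k => (h₂ k).trans (hC₃ k), h₃⟩

theorem exists_section_of_wellFounded {I : Type u} {r : I → I → Prop} (hr : WellFounded r)
    {X : Type v} (P : ∀ i, (∀ l, r l i → X) → X → Prop) (h : ∀ i g, ∃ x, P i g x) :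
    ∃ s : I → X, ∀ i, P i (fun l _ => s l) (s i) := by
  choose c hc using h
  refine ⟨hr.fix fun i g => c i g, fun i => ?_⟩
  have := hc i fun l _ => hr.fix (fun i g => c i g) l
  rwa [← hr.fix_eq (fun i g => c i g) i] at this

theorem IsWellFoundedTree.wellFounded_lt {I : Type u} [PartialOrder I]
    (hI : IsWellFoundedTree I) : WellFounded fun i k : I => i < k := by
  refine ⟨fun t => ?_⟩
  have h : WellFounded fun a b : Set.Iic t => (a : I) < b := hI.isWF_Iic t
  have : ∀ a : Set.Iic t, Acc (fun i k : I => i < k) a := fun a =>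
    h.induction (C := fun a => Acc (fun i k : I => i < k) a) a fun a ih =>
      ⟨_, fun l hl => ih ⟨l, hl.le.trans a.2⟩ hl⟩
  exact this ⟨t, le_rfl⟩

open Cardinal in
/-- A diagram over the product of a tree and `J` can be lifted if `Conc` of some diagram over `J`
has sufficiently many coherent projections onto it. -/
theorem hasLifting_of_coherent {L : FirstOrder.Language.{x, y}} [L.IsAlgebraic]
    {V : ObjectProperty (Alg.{u} L)} (hV : IsVariety V) {I : Type u} [PartialOrder I]
    (hI : IsWellFoundedTree I) {J : Type u} [SmallCategory J] {Ξ : Type u} {μ : Cardinal.{u}}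
    (hμ : ℵ₀ ≤ μ) (hJ : #(Arrow J) ≤ μ) (hIμ : ∀ i : I, #(Set.Iic i) ≤ μ) (hΞ : μ < #Ξ)
    (hloc : LocallyLE V μ) (D : I × J ⥤ SemilatSupCat.{u}) (hD : ∀ p, #(D.obj p) ≤ μ)
    (B : J ⥤ Alg.{u} L) (hB : ∀ j, V (B.obj j))
    (σ : ∀ (z : LabelledPoint I Ξ) (j : J), SupBotHom (Conc L (B.obj j)) (D.obj (z.1, j)))
    (hσ : ∀ z j, Conc.IsIdealQuotient (σ z j))
    (hnat : ∀ z {j j' : J} (f : j ⟶ j') (α : Conc L (B.obj j)),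
      σ z j' (Conc.map (Alg.toHom (B.map f)) α) =
        toSupBotHom (D.map (𝟙 z.1 ×ₘ f)) (σ z j α))
    (hcoh : ∀ j (α : Conc L (B.obj j)), ∃ F : Finset (I × Ξ), ∀ (z : LabelledPoint I Ξ) (l : I)
      (h : l ≤ z.1), (∀ (m : I) (hm : m ≤ z.1), l < m → (m, z.2 ⟨m, hm⟩) ∉ F) →
        σ z j α = toSupBotHom (D.map (homOfLE h ×ₘ 𝟙 j)) (σ (z.restrict h) j α)) :
    HasLifting V D := by
  classical
  choose supp hsupp using hcoh
  have hJμ : #J ≤ μ := mk_le_of_mk_arrow_le hJ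
  let Fam := {C : ∀ j, L.Substructure (B.obj j) // ∀ j, #(C j) ≤ μ}
  let bad : Fam → Set Ξ := fun C => ⋃ j, ⋃ α : Conc L (C.1 j),
    Prod.snd '' (supp j (Conc.map (C.1 j).subtype.toHom α) : Set (I × Ξ))
  have hbad : ∀ C, #(bad C) ≤ μ := fun C => mk_iUnion_le_of_le hμ hJμ fun j =>
    mk_iUnion_le_of_le hμ (Conc.mk_le_of_le hμ (C.2 j)) fun α =>
      mk_image_le.trans (mk_finset_coe_le hμ _)
  let good : LabelledPoint I Ξ → (∀ j, L.Substructure (B.obj j)) → Prop := fun z C =>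
    (∀ j, Nonempty (C j)) ∧
      (∀ {j j'} (f : j ⟶ j'), ∀ c ∈ C j, Alg.toHom (B.map f) c ∈ C j') ∧
      (∀ j, Function.Surjective ((σ z j).comp (Conc.mapHom (C j).subtype.toHom))) ∧
      ∀ j (α β : Conc L (C j)),
        (σ z j).comp (Conc.mapHom (C j).subtype.toHom) α ≤
            (σ z j).comp (Conc.mapHom (C j).subtype.toHom) β ↔
          α.1 ≤ Congr.gen (β.1.pairs ∪
            (Conc.congrLE ((σ z j).comp (Conc.mapHom (C j).subtype.toHom)) ⊥).pairs)
  obtain ⟨s, hs⟩ := exists_section_of_wellFounded hI.wellFounded_lt (X := Ξ × Fam)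
    (fun i g t => (∀ l h, t.1 ∉ bad (g l h).2) ∧ (∀ l h j, (g l h).2.1 j ≤ t.2.1 j) ∧
      good ⟨i, fun l => if h : l.1 < i then (g l.1 h).1 else t.1⟩ t.2.1) (by
    intro i g
    have hlt : #{l // l < i} ≤ μ :=
      (mk_subtype_mono fun l (h : l < i) => h.le).trans (hIμ i)
    have hξ : ∃ ξ, ξ ∉ ⋃ l : {l // l < i}, bad (g l.1 l.2).2 := by
      by_contra! h
      have h₁ := mk_iUnion_le_of_le hμ hlt (f := fun l => bad (g l.1 l.2).2) fun l => hbad _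
      rw [Set.eq_univ_of_forall h, mk_univ] at h₁
      exact absurd hΞ h₁.not_gt
    obtain ⟨ξ, hξ⟩ := hξ
    obtain ⟨C, hC₁, hC₂, hC₃, hC₄, hC₅, hC₆⟩ := exists_subalgebras_of_isIdealQuotient B hμ hJ
      (fun j S hS => hloc _ (hB j) S hS) (fun j => D.obj (i, j)) (fun j => hD _)
      (σ ⟨i, fun l => if h : l.1 < i then (g l.1 h).1 else ξ⟩) (hσ _)
      (fun j => ⋃ l : {l // l < i}, ((g l.1 l.2).2.1 j : Set (B.obj j)))
      (fun j => mk_iUnion_le_of_le hμ hlt fun l => (g l.1 l.2).2.2 j)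
    refine ⟨(ξ, ⟨C, hC₃⟩), fun l h hl => hξ (Set.mem_iUnion.2 ⟨⟨l, h⟩, hl⟩), fun l h j c hc => ?_,
      hC₂, hC₄, hC₅, hC₆⟩
    exact hC₁ j (Set.mem_iUnion.2 ⟨⟨l, h⟩, hc⟩))
  let pt : I → LabelledPoint I Ξ := fun i => ⟨i, fun l => (s l.1).1⟩
  let C : ∀ i j, L.Substructure (B.obj j) := fun i => (s i).2.1
  have hgood : ∀ i, good (pt i) (C i) := by
    intro i
    have h := (hs i).2.2
    have : (fun l : {l // l ≤ i} => if h : l.1 < i then (s l.1).1 else (s i).1) =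
        fun l => (s l.1).1 := by
      funext l
      split_ifs with hl
      · rfl
      · rw [l.2.eq_of_not_lt hl]
    rw [this] at h
    exact h
  have hmono : ∀ {l i}, l ≤ i → ∀ j, C l j ≤ C i j := by
    intro l i hli j
    rcases hli.eq_or_lt with rfl | h
    · exact le_rfl
    · exact (hs i).2.1 l h j
  have hkey : ∀ {l i} (h : l ≤ i) (j) (α : Conc L (C l j)),
      σ (pt i) j (Conc.map (C l j).subtype.toHom α) =
        toSupBotHom (D.map (homOfLE h ×ₘ 𝟙 j))
          (σ (pt l) j (Conc.map (C l j).subtype.toHom α)) := by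
    intro l i h j α
    refine hsupp j _ (pt i) l h fun m hm hlm hmem => ?_
    refine (hs m).1 l hlm (Set.mem_iUnion.2 ⟨j, Set.mem_iUnion.2 ⟨α, ?_⟩⟩)
    exact ⟨_, hmem, rfl⟩
  let B' : I × J ⥤ Alg.{u} L := CategoryTheory.Prod.snd I J ⋙ B
  let C' : ∀ p : I × J, L.Substructure (B'.obj p) := fun p => C p.1 p.2
  have : ∀ p, Nonempty (C' p) := fun p => (hgood p.1).1 p.2
  have hC' : ∀ {p q} (f : p ⟶ q), ∀ c ∈ C' p, Alg.toHom (B'.map f) c ∈ C' q := fun {p q} f c hc =>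
    (hgood q.1).2.1 f.2 c (hmono (leOfHom f.1) p.2 hc)
  let τ : ∀ p : I × J, SupBotHom (Conc L (C' p)) (D.obj p) := fun p =>
    (σ (pt p.1) p.2).comp (Conc.mapHom (C p.1 p.2).subtype.toHom)
  have hτ : ∀ {p q} (f : p ⟶ q) (α : Conc L (C' p)),
      τ q (Conc.map (Alg.toHom ((subFunctor B' C' hC').map f)) α) =
        toSupBotHom (D.map f) (τ p α) := by
    intro p q f α
    refine (congrArg (σ (pt q.1) q.2) (map_subtype_map_subFunctor B' C' hC' f α)).trans ?_
    refine (hnat (pt q.1) f.2 _).trans ?_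
    refine (congrArg _ (hkey (leOfHom f.1) p.2 α)).trans ?_
    have hf : f = (homOfLE (leOfHom f.1) ×ₘ 𝟙 p.2) ≫ (𝟙 q.1 ×ₘ f.2) :=
      Prod.hom_ext (Subsingleton.elim _ _) (Category.id_comp _).symm
    conv_rhs => rw [hf, D.map_comp]
    rfl
  obtain ⟨𝒜, h₁, -, h₃⟩ := hasLifting_of_surjective hV (subFunctor B' C' hC')
    (fun p => hV.sub _ _ (hB p.2)) D τ (fun p => (hgood p.1).2.2.1 p.2) hτ
    fun p => (hgood p.1).2.2.2 p.2
  exact hasLifting_iff.2 ⟨𝒜, h₁, h₃⟩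

open Cardinal in
theorem mk_arrow_prod_le {μ : Cardinal.{u}} (hμ : ℵ₀ ≤ μ) {I : Type u} [PartialOrder I]
    (hI : #I ≤ μ) {J : Type u} [SmallCategory J] (hJ : #(Arrow J) ≤ μ) :
    #(Arrow (I × J)) ≤ μ := by
  refine le_trans (mk_le_of_injective
    (f := fun a : Arrow (I × J) => ((a.left.1, a.right.1), Arrow.mk a.hom.2)) ?_)
    (mk_prod_le_of_le hμ (mk_prod_le_of_le hμ hI hI) hJ)
  rintro ⟨⟨i, j⟩, ⟨i', j'⟩, f⟩ ⟨⟨k, l⟩, ⟨k', l'⟩, g⟩ h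
  obtain ⟨f₁, f₂⟩ := f
  obtain ⟨g₁, g₂⟩ := g
  obtain ⟨h₁, h₂⟩ := Prod.ext_iff.1 h
  obtain ⟨h₃, h₄⟩ := Prod.ext_iff.1 h₁
  dsimp at h₂ h₃ h₄ f₁ g₁ f₂ g₂
  subst h₃ h₄
  obtain rfl : f₁ = g₁ := Subsingleton.elim _ _
  cases h₂
  rfl

open Cardinal in
/-- A lifting property for diagrams over `J` passes to diagrams over the product of a tree and `J`,
at the price of one cardinal. -/
theorem hasLifting_prod_of_hasLifting {L₁ : FirstOrder.Language.{x₁, y₁}} [L₁.IsAlgebraic]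
    {L₂ : FirstOrder.Language.{x₂, y₂}} [L₂.IsAlgebraic]
    {V₁ : ObjectProperty (Alg.{u} L₁)} (hV₁ : IsVariety V₁)
    {V₂ : ObjectProperty (Alg.{u} L₂)} (hV₂ : IsVariety V₂)
    {μ : Cardinal.{u}} (hμ : ℵ₀ ≤ μ) {I : Type u} [PartialOrder I] (hI : IsWellFoundedTree I)
    {J : Type u} [SmallCategory J] (hJ : #(Arrow J) ≤ μ) (hIμ : #I ≤ Order.succ μ)
    (hIic : ∀ i : I, #(Set.Iic i) ≤ μ) (hloc₁ : LocallyLE V₁ (Order.succ μ))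
    (hloc₂ : LocallyLE V₂ μ)
    (hlift : ∀ D : J ⥤ SemilatSupCat.{u}, (∀ j, #(D.obj j) ≤ Order.succ μ) →
      HasLifting V₁ D → HasLifting V₂ D)
    (D : I × J ⥤ SemilatSupCat.{u}) (hD : ∀ p, #(D.obj p) ≤ μ) (hD₁ : HasLifting V₁ D) :
    HasLifting V₂ D := by
  classical
  have hsucc : μ ≤ Order.succ μ := Order.le_succ μ
  have hμ' : ℵ₀ ≤ Order.succ μ := hμ.trans hsucc
  obtain ⟨𝒜, h𝒜, h𝒜μ, ⟨e⟩⟩ := hD₁.exists_mk_le hV₁ hμ'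
    (mk_arrow_prod_le hμ' hIμ (hJ.trans hsucc)) hloc₁ fun p => (hD p).trans hsucc
  let Ξ : Type u := (Order.succ μ).out
  have hΞ : #Ξ = Order.succ μ := mk_out _
  have : Nonempty Ξ := mk_ne_zero_iff.1 (by rw [hΞ]; exact (aleph0_pos.trans_le hμ').ne')
  obtain ⟨𝒞, h𝒞, h𝒞μ, π, hπ, hπnat, hπcoh⟩ :=
    exists_condensate hI 𝒜 Ξ V₁ hV₁ hμ' hloc₁ hIμ hΞ.le h𝒜μ h𝒜
  obtain ⟨B, hB, ⟨φ⟩⟩ := hasLifting_iff.1 (hlift (𝒞 ⋙ concFunctor L₁)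
    (fun j => Conc.mk_le_of_le hμ' (h𝒞μ j)) (hasLifting_iff.2 ⟨𝒞, h𝒞, ⟨Iso.refl _⟩⟩))
  let eo : ∀ p, Conc L₁ (𝒜.obj p) ≃o D.obj p := fun p => orderIsoOfIso (e.app p)
  let φo : ∀ j, Conc L₂ (B.obj j) ≃o Conc L₁ (𝒞.obj j) := fun j => orderIsoOfIso (φ.app j)
  have he : ∀ {p q} (f : p ⟶ q) (α : Conc L₁ (𝒜.obj p)),
      eo q (Conc.map (Alg.toHom (𝒜.map f)) α) = toSupBotHom (D.map f) (eo p α) :=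
    fun {p q} f α => DFunLike.congr_fun (F := SupBotHom (Conc L₁ (𝒜.obj p)) (D.obj q))
      (e.hom.naturality f) α
  have hφ : ∀ {j j'} (f : j ⟶ j') (α : Conc L₂ (B.obj j)),
      φo j' (Conc.map (Alg.toHom (B.map f)) α) = Conc.map (Alg.toHom (𝒞.map f)) (φo j α) :=
    fun {j j'} f α => DFunLike.congr_fun
      (F := SupBotHom (Conc L₂ (B.obj j)) (Conc L₁ (𝒞.obj j'))) (φ.hom.naturality f) α
  let σ : ∀ (z : LabelledPoint I Ξ) (j : J), SupBotHom (Conc L₂ (B.obj j)) (D.obj (z.1, j)) :=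
    fun z j => (eo (z.1, j) : SupBotHom _ _).comp ((Conc.mapHom (π z j)).comp
      (φo j : SupBotHom _ _))
  have hσ : ∀ z j α, σ z j α = eo (z.1, j) (Conc.map (π z j) (φo j α)) := fun _ _ _ => rfl
  refine hasLifting_of_coherent hV₂ hI hμ hJ hIic (by rw [hΞ]; exact Order.lt_succ μ) hloc₂ D hD B
    hB σ ?_ ?_ ?_
  · intro z j
    refine ⟨(eo _).surjective.comp ((Conc.map_surjective (hπ z j)).comp (φo j).surjective),
      fun α β h => ?_⟩
    rw [hσ, hσ, OrderIso.le_iff_le] at h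
    obtain ⟨γ, hγ, hαβ⟩ := Conc.exists_le_sup_of_map_le (hπ z j) h
    refine ⟨(φo j).symm γ, ?_, ?_⟩
    · rw [hσ, OrderIso.apply_symm_apply, hγ, map_bot]
    · rw [← (φo j).le_iff_le, map_sup, OrderIso.apply_symm_apply]
      exact hαβ
  · intro z j j' f α
    rw [hσ, hσ, hφ, ← he, ← Conc.map_comp_apply, ← Conc.map_comp_apply]
    congr 2
    apply FirstOrder.Language.Hom.ext
    exact hπnat z f
  · intro j α
    choose F hF using hπcoh j
    obtain ⟨P, hP⟩ := Conc.exists_eq_genF (φo j α)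
    refine ⟨P.biUnion fun p => F p.1 ∪ F p.2, fun z l h hm => ?_⟩
    refine Eq.trans (congrArg (eo (z.1, j)) ?_) (he (p := (l, j)) (homOfLE h ×ₘ 𝟙 j)
      (Conc.map (π (z.restrict h) j) (φo j α)))
    change Conc.map (π z j) (φo j α) =
      Conc.map (trans₁ 𝒜 h j) (Conc.map (π (z.restrict h) j) (φo j α))
    rw [hP, ← Conc.map_comp_apply, Conc.map_genF, Conc.map_genF]
    congr 1
    refine Finset.image_congr fun p hp => ?_
    have hsub : F p.1 ∪ F p.2 ⊆ P.biUnion fun p => F p.1 ∪ F p.2 :=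
      Finset.subset_biUnion_of_mem (fun p => F p.1 ∪ F p.2) hp
    refine Prod.ext ?_ ?_
    · exact hF p.1 z l h fun m hmz hlm hmem =>
        hm m hmz hlm (hsub (Finset.mem_union_left _ hmem))
    · exact hF p.2 z l h fun m hmz hlm hmem =>
        hm m hmz hlm (hsub (Finset.mem_union_right _ hmem))

section Reindexing

variable {n : ℕ} (I : Fin (n + 1) → Type u) [∀ k, PartialOrder (I k)]
  (J : Type u) [SmallCategory J]

/-- Splitting off the first factor of a product of posets. -/
def splitFirst : PosetProd I × J ⥤ PosetProd (fun k => I k.succ) × (I 0 × J) where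
  obj p := (fun k => p.1 k.succ, (p.1 0, p.2))
  map f := (homOfLE fun k => leOfHom f.1 k.succ) ×ₘ ((homOfLE (leOfHom f.1 0)) ×ₘ f.2)
  map_id _ := rfl
  map_comp _ _ := rfl

/-- Putting back the first factor of a product of posets. -/
def consFirst : PosetProd (fun k => I k.succ) × (I 0 × J) ⥤ PosetProd I × J where
  obj p := (Fin.cons p.2.1 p.1, p.2.2)
  map {p q} f := (homOfLE (Fin.cons (leOfHom f.2.1) fun k => leOfHom f.1 k :
    ∀ k, (Fin.cons p.2.1 p.1 : ∀ k, I k) k ≤ (Fin.cons q.2.1 q.1 : ∀ k, I k) k)) ×ₘ f.2.2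
  map_id _ := rfl
  map_comp _ _ := rfl

/-- Splitting off the first factor and putting it back is the identity. -/
def splitFirstConsFirstIso : splitFirst I J ⋙ consFirst I J ≅ 𝟭 (PosetProd I × J) :=
  NatIso.ofComponents
    (fun p => (eqToIso (C := PosetProd I) (Fin.cons_self_tail p.1)).prod (Iso.refl p.2))
    fun _ => Prod.hom_ext (Subsingleton.elim _ _)
      ((Category.comp_id _).trans (Category.id_comp _).symm)

end Reindexing

/-- The inclusion of `J` into its product with the product of no posets. -/
def inclEmpty (I : Fin 0 → Type u) [∀ k, PartialOrder (I k)] (J : Type u) [SmallCategory J] :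
    J ⥤ PosetProd I × J :=
  ((Functor.const J).obj (show PosetProd I from fun k => k.elim0)).prod' (𝟭 J)

/-- The product of no posets is trivial. -/
def sndInclEmptyIso (I : Fin 0 → Type u) [∀ k, PartialOrder (I k)] (J : Type u)
    [SmallCategory J] :
    CategoryTheory.Prod.snd (PosetProd I) J ⋙ inclEmpty I J ≅ 𝟭 (PosetProd I × J) :=
  NatIso.ofComponents
    (fun p => (eqToIso (C := PosetProd I) (funext fun k => k.elim0)).prod (Iso.refl p.2))
    fun _ => Prod.hom_ext (Subsingleton.elim _ _)
      ((Category.comp_id _).trans (Category.id_comp _).symm)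

open Cardinal in
/-- A lifting property for diagrams over `J` passes to diagrams over the product of `n` trees and
`J`, at the price of `n` cardinals. -/
theorem hasLifting_posetProd {L₁ : FirstOrder.Language.{x₁, y₁}} [L₁.IsAlgebraic]
    {L₂ : FirstOrder.Language.{x₂, y₂}} [L₂.IsAlgebraic]
    {V₁ : ObjectProperty (Alg.{u} L₁)} (hV₁ : IsVariety V₁)
    {V₂ : ObjectProperty (Alg.{u} L₂)} (hV₂ : IsVariety V₂)
    {κ : Cardinal.{u}} (hκ : ℵ₀ ≤ κ) (hloc₁ : LocallyLE V₁ (Order.succ κ))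
    (hloc₂ : LocallyLE V₂ κ) (n : ℕ) :
    ∀ (I : Fin n → Type u) [∀ k, PartialOrder (I k)], (∀ k, IsWellFoundedTree (I k)) →
      (∀ k : Fin n, k.val + 1 < n → #(I k) ≤ κ) →
      (∀ k : Fin n, k.val + 1 = n → #(I k) ≤ Order.succ κ) →
      (∀ k : Fin n, k.val + 1 = n → ∀ i : I k, #(Set.Iic i) ≤ κ) →
      ∀ (J : Type u) [SmallCategory J], (n ≠ 0 → #(Arrow J) ≤ κ) →
        (∀ D : J ⥤ SemilatSupCat.{u}, (∀ j, #(D.obj j) ≤ Order.succ^[n] κ) →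
          HasLifting V₁ D → HasLifting V₂ D) →
        ∀ D : PosetProd I × J ⥤ SemilatSupCat.{u}, (∀ p, #(D.obj p) ≤ κ) →
          HasLifting V₁ D → HasLifting V₂ D := by
  induction n with
  | zero =>
    intro I _ _ _ _ _ J _ _ hlift D hD hD₁
    have h := hlift (inclEmpty I J ⋙ D) (fun j => hD _) (hD₁.comp _)
    exact (h.comp (CategoryTheory.Prod.snd (PosetProd I) J)).of_iso
      (Functor.isoWhiskerRight (sndInclEmptyIso I J) D)
  | succ n ih =>
    intro I _ hI hsmall hlast hdown J _ hJ hlift D hD hD₁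
    have hJκ := hJ n.succ_ne_zero
    have hκn : κ ≤ Order.succ^[n] κ := Function.id_le_iterate_of_id_le (Order.le_succ ·) n κ
    have h0 : #(I 0) ≤ Order.succ κ := by
      rcases Nat.eq_zero_or_pos n with rfl | hn
      · exact hlast 0 rfl
      · exact (hsmall 0 (by simpa using hn)).trans (Order.le_succ κ)
    have h0' : ∀ i : I 0, #(Set.Iic i) ≤ κ := by
      rcases Nat.eq_zero_or_pos n with rfl | hn
      · exact hdown 0 rfl
      · exact fun i => (mk_set_le _).trans (hsmall 0 (by simpa using hn))
    have hstep : ∀ D : I 0 × J ⥤ SemilatSupCat.{u}, (∀ p, #(D.obj p) ≤ Order.succ^[n] κ) →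
        HasLifting V₁ D → HasLifting V₂ D :=
      hasLifting_prod_of_hasLifting hV₁ hV₂ (hκ.trans hκn) (hI 0) (hJκ.trans hκn)
        (h0.trans (Order.succ_le_succ hκn)) (fun i => (h0' i).trans hκn)
        (fun A hA S hS => (hloc₁ A hA S hS).trans (Order.succ_le_succ hκn))
        (fun A hA S hS => (hloc₂ A hA S hS).trans hκn)
        (by rwa [Function.iterate_succ_apply'] at hlift)
    have h := ih (fun k => I k.succ) (fun k => hI k.succ)
      (fun k hk => hsmall k.succ (by simpa using hk)) (fun k hk => hlast k.succ (by simpa using hk))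
      (fun k hk => hdown k.succ (by simpa using hk)) (I 0 × J)
      (fun hn => mk_arrow_prod_le hκ (hsmall 0 (by simpa using Nat.pos_of_ne_zero hn)) hJκ) hstep
      (consFirst I J ⋙ D) (fun p => hD _) (hD₁.comp _)
    exact (h.comp (splitFirst I J)).of_iso (Functor.isoWhiskerRight (splitFirstConsFirstIso I J) D)

end LiftingDiagrams

theorem corollaryC
    {L₁ : FirstOrder.Language.{x₁, y₁}} [L₁.IsAlgebraic]
    {L₂ : FirstOrder.Language.{x₂, y₂}} [L₂.IsAlgebraic]
    (V₁ : ObjectProperty (LiftingDiagrams.Alg.{u} L₁)) (hV₁ : LiftingDiagrams.IsVariety V₁)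
    (V₂ : ObjectProperty (LiftingDiagrams.Alg.{u} L₂)) (hV₂ : LiftingDiagrams.IsVariety V₂)
    (κ : Cardinal.{u}) (hκ : Cardinal.aleph0 ≤ κ)
    (n : ℕ) (I : Fin n → Type u) [∀ k, PartialOrder (I k)]
    (hI : ∀ k, LiftingDiagrams.IsWellFoundedTree (I k))
    (J : Type u) [SmallCategory J]
    (hloc₁ : LiftingDiagrams.LocallyLE V₁ (Order.succ κ))
    (hloc₂ : LiftingDiagrams.LocallyLE V₂ κ)
    (hcard : (∑ k : Fin n with k.val + 1 < n, Cardinal.mk (I k)) + Cardinal.mk (Arrow J) ≤ κ)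
    (hlast : ∀ k : Fin n, k.val + 1 = n → Cardinal.mk (I k) ≤ Order.succ κ)
    (hdown : ∀ k : Fin n, k.val + 1 = n → ∀ i : I k, Cardinal.mk (Set.Iic i) ≤ κ)
    (hlift : ∀ D : J ⥤ SemilatSupCat.{u},
      (∀ j, Cardinal.mk (D.obj j) ≤ Order.succ^[n] κ) →
        LiftingDiagrams.HasLifting V₁ D → LiftingDiagrams.HasLifting V₂ D)
    (D : LiftingDiagrams.PosetProd I × J ⥤ SemilatSupCat.{u})
    (hD : ∀ p, Cardinal.mk (D.obj p) ≤ κ)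
    (hD₁ : LiftingDiagrams.HasLifting V₁ D) :
    LiftingDiagrams.HasLifting V₂ D := by
  refine LiftingDiagrams.hasLifting_posetProd hV₁ hV₂ hκ hloc₁ hloc₂ n I hI (fun k hk => ?_) hlast
    hdown J (fun _ => le_trans le_add_self hcard) hlift D hD hD₁
  refine le_trans ?_ (le_trans le_self_add hcard)
  exact Finset.single_le_sum (f := fun k => Cardinal.mk (I k)) (fun _ _ => zero_le)
    (Finset.mem_filter.2 ⟨Finset.mem_univ k, hk⟩)
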